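/- Let $r,T>0$, let $(\Omega,\mathcal F,\mathbb P)$ be a probability space carrying a standard real Brownian motion $W_0$, and let $\mathbb F=(\mathcal F_s)_{s\ge 0}$ be the completion (by the $\mathbb P$-null events) of the filtration generated by $W_0$. Let $a_0,b_0,\sigma\in\mathbb R$ and $a_1,b_1\in L^2([-r,0];\mathbb R)$. Let $z\in\mathcal U:=L^2_{\mathbb F}([0,T];\mathbb R_+)$, i.e. $z$ is a non-negative $\mathbb F$-adapted process with $\mathbb E\int_0^T z(s)^2\,ds<\infty$. Let $X=\mathbb R\times L^2([-r,0];\mathbb R)$ with inner product $\langle x,y\rangle=x_0y_0+\int_{-r}^0x_1(\xi)y_1(\xi)\,d\xi$. Let $A(x_0,x_1)=(a_0x_0+x_1(0),\,a_1(\cdot)x_0-x_1')$ on $D(A)=\{x\in X: x_1\in W^{1,2}([-r,0];\mathbb R),\ x_1(-r)=0\}$, which is the adjoint of $A^*(x_0,x_1)=(a_0x_0+\int_{-r}^0a_1(\xi)x_1(\xi)\,d\xi,\ x_1')$ on $D(A^*)=\{x\in X: x_1\in W^{1,2}([-r,0];\mathbb R),\ x_0=x_1(0)\}$. Let $Bu=(b_0u,b_1(\cdot)u)$,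 $Gx_0=(\sigma x_0,0)$, and let $M:X\times L^2([-r,0];\mathbb R)\to X$ be $M(x_0,x_1,v)=(x_0,m)$ with $$m(\xi)=\int_{-r}^{\xi}a_1(\zeta)x_1(\zeta-\xi)\,d\zeta+\int_{-r}^{\xi}b_1(\zeta)v(\zeta-\xi)\,d\zeta .$$ A weak solution of $$dY(s)=(AY(s)+Bz(s))\,ds+G\,dW_0(s),\qquad Y(0)=x\in X,\qquad (1)$$ on $[0,T]$ is an $X$-valued predictable process $Y=(Y_0,Y_1)$ with a.s. Bochner integrable trajectories such that for every $\zeta\in D(A^*)$ and $t\in[0,T]$, $\mathbb P$-a.s., $$\langle Y(t),\zeta\rangle=\langle x,\zeta\rangle+\int_0^t\big(\langle Y(s),A^*\zeta\rangle+\langle Bz(s),\zeta\rangle\big)\,ds+\langle GW_0(t),\zeta\rangle .$$ (i) Let $Y$ be the weak solution of (1) with continuous paths, for an arbitrary $x\in X$. Then, $\mathbb P$-a.s., for all $t\in[r,T]$ the functions $\xi\mapsto Y_0(t+\xi)$ and $\xi\mapsto z(t+\xi)$ are in $L^2([-r,0];\mathbb R)$ and $$Y(t)=M\big(Y_0(t),\,Y_0(t+\cdot),\,z(t+\cdot)\big).$$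 (ii) Let $\eta^0\in\mathbb R$ and $\eta,\delta\in L^2([-r,0];\mathbb R)$, and extend $z$ by $z(\xi)=\delta(\xi)$ for $\xi\in[-r,0)$. Let $\{y(t),\,t\in[-r,T]\}$ be a solution of $$dy(s)=\Big[a_0y(s)+\int_{-r}^0a_1(\xi)y(s+\xi)\,d\xi+b_0z(s)+\int_{-r}^0b_1(\xi)z(s+\xi)\,d\xi\Big]ds+\sigma\,dW_0(s),\qquad 0\le s\le T,$$ with $y(0)=\eta^0$ and $y(\xi)=\eta(\xi)$ for $\xi\in[-r,0)$, which is $\mathbb F$-adapted and a.s. continuous on $[0,T]$. Let $Y$ be the weak solution of (1) with continuous paths and with initial datum $x=M(\eta^0,\eta,\delta)$. Then, $\mathbb P$-a.s., for all $t\in[0,T]$ the functions $\xi\mapsto y(t+\xi)$ and $\xi\mapsto z(t+\xi)$ are in $L^2([-r,0];\mathbb R)$ and $$Y(t)=M\big(y(t),\,y(t+\cdot),\,z(t+\cdot)\big),$$ hence $y(t)=Y_0(t)$. -/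

import Mathlib

open MeasureTheory ProbabilityTheory Set
open scoped NNReal ENNReal InnerProductSpace

noncomputable section

namespace DelaySDE

/-! ### The state space -/

/-- Lebesgue measure on the delay interval `[-r, 0]`. -/
abbrev delayMeasure (r : ℝ) : Measure ℝ := volume.restrict (Icc (-r) 0)

/-- The space `L²([-r, 0]; ℝ)`. -/
abbrev L2 (r : ℝ) : Type := Lp ℝ 2 (delayMeasure r)

/-- The Hilbert space `X = ℝ × L²([-r, 0]; ℝ)` with inner product
`⟪x, y⟫ = x₀ y₀ + ∫_{-r}^0 x₁(ξ) y₁(ξ) dξ`. -/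
abbrev X (r : ℝ) : Type := WithLp 2 (ℝ × L2 r)

/-- The element `(x₀, x₁)` of `X`. -/
abbrev mkX {r : ℝ} (x₀ : ℝ) (x₁ : L2 r) : X r := WithLp.toLp 2 (x₀, x₁)

/-! ### The unbounded operators `A` and `A*` -/

/-- `u ∈ W^{1,2}([-r, 0])`, with weak derivative `u' ∈ L²([-r, 0])` and with absolutely continuous
representative `f` on `[-r, 0]`. -/
structure IsW12 {r : ℝ} (u u' : L2 r) (f : ℝ → ℝ) : Prop where
  ac : AbsolutelyContinuousOnInterval f (-r) 0
  rep : u =ᵐ[delayMeasure r] f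
  weakDeriv : u' =ᵐ[delayMeasure r] deriv f

lemma ae_differentiableAt_of_ac {r : ℝ} {f : ℝ → ℝ}
    (hf : AbsolutelyContinuousOnInterval f (-r) 0) :
    ∀ᵐ ξ ∂(delayMeasure r), DifferentiableAt ℝ f ξ := by
  rw [ae_restrict_iff' measurableSet_Icc]
  filter_upwards [hf.ae_differentiableAt] with ξ hξ hmem
  exact hξ (Icc_subset_uIcc hmem)

lemma IsW12.add {r : ℝ} {u u' v v' : L2 r} {f g : ℝ → ℝ}
    (hf : IsW12 u u' f) (hg : IsW12 v v' g) : IsW12 (u + v) (u' + v') (f + g) := by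
  refine ⟨hf.ac.add hg.ac, ?_, ?_⟩
  · filter_upwards [Lp.coeFn_add u v, hf.rep, hg.rep] with ξ h1 h2 h3
    rw [h1, Pi.add_apply, h2, h3, Pi.add_apply]
  · filter_upwards [Lp.coeFn_add u' v', hf.weakDeriv, hg.weakDeriv,
      ae_differentiableAt_of_ac hf.ac, ae_differentiableAt_of_ac hg.ac] with ξ h1 h2 h3 h4 h5
    rw [h1, deriv_add h4 h5, Pi.add_apply, h2, h3]

lemma IsW12.smul {r : ℝ} {u u' : L2 r} {f : ℝ → ℝ} (c : ℝ)
    (hf : IsW12 u u' f) : IsW12 (c • u) (c • u') (c • f) := by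
  refine ⟨hf.ac.const_smul c, ?_, ?_⟩
  · filter_upwards [Lp.coeFn_smul c u, hf.rep] with ξ h1 h2
    simp [h1, h2]
  · filter_upwards [Lp.coeFn_smul c u', hf.weakDeriv,
      ae_differentiableAt_of_ac hf.ac] with ξ h1 h2 h3
    rw [h1, deriv_const_smul c h3, Pi.smul_apply, h2]

lemma IsW12.zero {r : ℝ} : IsW12 (0 : L2 r) 0 0 := by
  refine ⟨?_, Lp.coeFn_zero _ _ _, ?_⟩
  · exact (LipschitzOnWith.absolutelyContinuousOnInterval (K := 0)
      (by intro x _ y _; simp))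
  · filter_upwards [Lp.coeFn_zero ℝ 2 (delayMeasure r)] with ξ h1
    rw [h1]; simp

lemma IsW12.eqOn_zero {r : ℝ} (hr : 0 < r) {u' : L2 r} {f : ℝ → ℝ}
    (hf : IsW12 (0 : L2 r) u' f) : EqOn f 0 (Icc (-r) 0) ∧ u' = 0 := by
  have h0 : EqOn f 0 (Icc (-r) 0) := by
    refine Measure.eqOn_Icc_of_ae_eq volume (by linarith) ?_ ?_ continuousOn_const
    · exact hf.rep.symm.trans (Lp.coeFn_zero _ _ _)
    · have := hf.ac.continuousOn
      rwa [uIcc_of_le (by linarith)] at this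
  refine ⟨h0, ?_⟩
  rw [Lp.eq_zero_iff_ae_eq_zero]
  refine hf.weakDeriv.trans ?_
  have : ∀ᵐ ξ ∂(delayMeasure r), ξ ∈ Ioo (-r) 0 := by
    rw [delayMeasure, ← Measure.restrict_congr_set Ioo_ae_eq_Icc]
    exact ae_restrict_mem measurableSet_Ioo
  filter_upwards [this] with ξ hξ
  have hev : f =ᶠ[nhds ξ] fun _ => (0 : ℝ) := by
    filter_upwards [isOpen_Ioo.mem_nhds hξ] with y hy
    exact h0 (Ioo_subset_Icc_self hy)
  rw [hev.deriv_eq]; simp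

/-- The graph of `A`. -/
def graphA {r : ℝ} (a₀ : ℝ) (a₁ : L2 r) : Submodule ℝ (X r × X r) where
  carrier := {p | ∃ (u' : L2 r) (f : ℝ → ℝ), IsW12 p.1.snd u' f ∧ f (-r) = 0 ∧
    p.2 = mkX (a₀ * p.1.fst + f 0) (p.1.fst • a₁ - u')}
  add_mem' := by
    rintro p q ⟨u, f, hf, hf0, hp⟩ ⟨v, g, hg, hg0, hq⟩
    refine ⟨u + v, f + g, hf.add hg, by simp [hf0, hg0], ?_⟩
    rw [Prod.snd_add, hp, hq, mkX, mkX, ← WithLp.toLp_add, Prod.mk_add_mk]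
    congr 2
    · simp; ring
    · simp [add_smul]; abel
  zero_mem' := ⟨0, 0, IsW12.zero, by simp, by simp [mkX]; rfl⟩
  smul_mem' := by
    rintro c p ⟨u, f, hf, hf0, hp⟩
    refine ⟨c • u, c • f, hf.smul c, by simp [hf0], ?_⟩
    rw [Prod.smul_snd, hp, mkX, ← WithLp.toLp_smul, Prod.smul_mk]
    congr 2
    · simp; ring
    · simp [smul_sub, mul_smul]

/-- The operator `A (x₀, x₁) = (a₀ x₀ + x₁(0), a₁(·) x₀ - x₁')` with domain
`{(x₀, x₁) : x₁ ∈ W^{1,2}([-r, 0]), x₁(-r) = 0}`. -/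
def opA {r : ℝ} (a₀ : ℝ) (a₁ : L2 r) : X r →ₗ.[ℝ] X r := (graphA a₀ a₁).toLinearPMap

lemma mem_graph_opA_iff {r : ℝ} (hr : 0 < r) (a₀ : ℝ) (a₁ : L2 r) (x w : X r) :
    (x, w) ∈ (opA a₀ a₁).graph ↔ ∃ (x₁' : L2 r) (f : ℝ → ℝ), IsW12 x.snd x₁' f ∧ f (-r) = 0 ∧
      w = mkX (a₀ * x.fst + f 0) (x.fst • a₁ - x₁') := by
  rw [opA, Submodule.toLinearPMap_graph_eq]
  · rfl
  · rintro ⟨p, q⟩ ⟨u, f, hf, hf0, hq⟩ h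
    simp only at h hq hf ⊢
    subst h
    obtain ⟨h1, rfl⟩ := IsW12.eqOn_zero hr hf
    rw [hq, h1 ⟨by linarith, le_rfl⟩]
    simp [mkX]

/-- The graph of `A*`. -/
def graphAStar {r : ℝ} (a₀ : ℝ) (a₁ : L2 r) : Submodule ℝ (X r × X r) where
  carrier := {p | ∃ (u' : L2 r) (f : ℝ → ℝ), IsW12 p.1.snd u' f ∧ f 0 = p.1.fst ∧
    p.2 = mkX (a₀ * p.1.fst + ⟪a₁, p.1.snd⟫_ℝ) u'}
  add_mem' := by
    rintro p q ⟨u, f, hf, hf0, hp⟩ ⟨v, g, hg, hg0, hq⟩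
    refine ⟨u + v, f + g, hf.add hg, by simp [hf0, hg0], ?_⟩
    rw [Prod.snd_add, hp, hq, mkX, mkX, ← WithLp.toLp_add, Prod.mk_add_mk]
    congr 2
    simp [inner_add_right]; ring
  zero_mem' := ⟨0, 0, IsW12.zero, by simp, by simp [mkX]; rfl⟩
  smul_mem' := by
    rintro c p ⟨u, f, hf, hf0, hp⟩
    refine ⟨c • u, c • f, hf.smul c, by simp [hf0], ?_⟩
    rw [Prod.smul_snd, hp, mkX, ← WithLp.toLp_smul, Prod.smul_mk]
    congr 2
    simp [inner_smul_right]; ring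

/-- The operator `A* (x₀, x₁) = (a₀ x₀ + ∫_{-r}^0 a₁(ξ) x₁(ξ) dξ, x₁')` with domain
`{(x₀, x₁) : x₁ ∈ W^{1,2}([-r, 0]), x₀ = x₁(0)}`. -/
def opAStar {r : ℝ} (a₀ : ℝ) (a₁ : L2 r) : X r →ₗ.[ℝ] X r := (graphAStar a₀ a₁).toLinearPMap

lemma mem_graph_opAStar_iff {r : ℝ} (hr : 0 < r) (a₀ : ℝ) (a₁ : L2 r) (x w : X r) :
    (x, w) ∈ (opAStar a₀ a₁).graph ↔ ∃ (x₁' : L2 r) (f : ℝ → ℝ), IsW12 x.snd x₁' f ∧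
      f 0 = x.fst ∧ w = mkX (a₀ * x.fst + ∫ ξ, a₁ ξ * x.snd ξ ∂(delayMeasure r)) x₁' := by
  rw [opAStar, Submodule.toLinearPMap_graph_eq]
  · have h : ∫ ξ, a₁ ξ * x.snd ξ ∂(delayMeasure r) = ⟪a₁, x.snd⟫_ℝ := by
      rw [L2.inner_def]
      refine integral_congr_ae (Filter.Eventually.of_forall fun ξ => ?_)
      simp [mul_comm]
    rw [h]; rfl
  · rintro ⟨p, q⟩ ⟨u, f, hf, hf0, hq⟩ h
    simp only at h hq hf ⊢
    subst h
    obtain ⟨h1, rfl⟩ := IsW12.eqOn_zero hr hf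
    rw [hq]
    simp [mkX]

/-- `A` and `A*` are in duality: `⟪A x, y⟫ = ⟪x, A* y⟫` for `x ∈ D(A)`, `y ∈ D(A*)`. -/
theorem opA_isFormalAdjoint {r : ℝ} (hr : 0 < r) (a₀ : ℝ) (a₁ : L2 r) :
    (opA a₀ a₁).IsFormalAdjoint (opAStar a₀ a₁) := by
  intro x y
  obtain ⟨x', f, hf, hf0, hx⟩ := (mem_graph_opA_iff hr a₀ a₁ _ _).1 ((opA a₀ a₁).mem_graph x)
  obtain ⟨y', g, hg, hg0, hy⟩ :=
    (mem_graph_opAStar_iff hr a₀ a₁ _ _).1 ((opAStar a₀ a₁).mem_graph y)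
  have key : ⟪x', (y : X r).snd⟫_ℝ = f 0 * g 0 - ⟪(x : X r).snd, y'⟫_ℝ := by
    have hp := hf.ac.integral_mul_deriv_eq_deriv_mul hg.ac
    rw [hf0, zero_mul, sub_zero] at hp
    have e : ∀ φ : ℝ → ℝ, ∫ ξ in (-r)..0, φ ξ = ∫ ξ, φ ξ ∂(delayMeasure r) := fun φ => by
      rw [intervalIntegral.integral_of_le (by linarith), integral_Icc_eq_integral_Ioc]
    rw [e, e] at hp
    have e1 : ⟪x', (y : X r).snd⟫_ℝ = ∫ ξ, deriv f ξ * g ξ ∂(delayMeasure r) := by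
      rw [L2.inner_def]
      refine integral_congr_ae ?_
      filter_upwards [hf.weakDeriv, hg.rep] with ξ h1 h2
      simp [h1, h2, mul_comm]
    have e2 : ⟪(x : X r).snd, y'⟫_ℝ = ∫ ξ, f ξ * deriv g ξ ∂(delayMeasure r) := by
      rw [L2.inner_def]
      refine integral_congr_ae ?_
      filter_upwards [hf.rep, hg.weakDeriv] with ξ h1 h2
      simp [h1, h2, mul_comm]
    rw [e1, e2]; linarith
  have h : ∫ ξ, a₁ ξ * (y : X r).snd ξ ∂(delayMeasure r) = ⟪a₁, (y : X r).snd⟫_ℝ := by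
    rw [L2.inner_def]
    refine integral_congr_ae (Filter.Eventually.of_forall fun ξ => ?_)
    simp [mul_comm]
  rw [hx, hy, h]
  simp only [WithLp.prod_inner_apply, inner_sub_left, inner_smul_left]
  simp only [WithLp.ofLp_fst, WithLp.ofLp_snd] at *
  rw [key, hg0]
  simp
  ring

/-! ### The bounded operators `B`, `G` and `M` -/

/-- The control operator `B u = (b₀ u, b₁(·) u)`. -/
def opB {r : ℝ} (b₀ : ℝ) (b₁ : L2 r) : ℝ →L[ℝ] X r :=
  ContinuousLinearMap.toSpanSingleton ℝ (mkX b₀ b₁)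

/-- The noise operator `G x₀ = (σ x₀, 0)`. -/
def opG (r σ : ℝ) : ℝ →L[ℝ] X r := ContinuousLinearMap.toSpanSingleton ℝ (mkX σ 0)

/-- `ξ ↦ ∫_{-r}^ξ a(ζ) u(ζ - ξ) dζ`, where `ζ - ξ` ranges over `[-r - ξ, 0] ⊆ [-r, 0]`. -/
def delayConv {r : ℝ} (a u : L2 r) (ξ : ℝ) : ℝ := ∫ ζ in (-r)..ξ, a ζ * u (ζ - ξ)

lemma memLp_delayConv {r : ℝ} (a u : L2 r) : MemLp (delayConv a u) 2 (delayMeasure r) := by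
  have hu := (Lp.memLp u).integrable_sq
  have ha := (Lp.memLp a).integrable_sq
  have hsa : StronglyMeasurable a := Lp.stronglyMeasurable a
  have hsu : StronglyMeasurable u := Lp.stronglyMeasurable u
  have hmeas : StronglyMeasurable
      (fun ξ => ∫ ζ, (Ioc (-r) ξ).indicator (fun ζ => a ζ * u (ζ - ξ)) ζ) := by
    refine StronglyMeasurable.integral_prod_right (f := fun ξ ζ =>
      (Ioc (-r) ξ).indicator (fun ζ => a ζ * u (ζ - ξ)) ζ) ?_
    have hS : MeasurableSet {p : ℝ × ℝ | -r < p.2 ∧ p.2 ≤ p.1} :=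
      (measurableSet_lt measurable_const measurable_snd).inter
        (measurableSet_le measurable_snd measurable_fst)
    have h1 : StronglyMeasurable (fun p : ℝ × ℝ => a p.2 * u (p.2 - p.1)) :=
      (hsa.comp_measurable measurable_snd).mul
        (hsu.comp_measurable (measurable_snd.sub measurable_fst))
    exact h1.indicator hS
  refine MemLp.of_bound (C := (∫ ξ, (a ξ) ^ 2 ∂(delayMeasure r)) +
    ∫ ξ, (u ξ) ^ 2 ∂(delayMeasure r)) ?_ ?_
  · refine hmeas.aestronglyMeasurable.congr ?_
    filter_upwards [ae_restrict_mem measurableSet_Icc] with ξ hξ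
    rw [delayConv, intervalIntegral.integral_of_le hξ.1, integral_indicator measurableSet_Ioc]
  · filter_upwards [ae_restrict_mem measurableSet_Icc] with ξ hξ
    have ha' : IntervalIntegrable (fun ζ => (a ζ) ^ 2) volume (-r) ξ := by
      rw [intervalIntegrable_iff_integrableOn_Ioc_of_le hξ.1]
      exact IntegrableOn.mono_set ha
        (fun ζ hζ => ⟨hζ.1.le, hζ.2.trans hξ.2⟩)
    have hu0 : IntervalIntegrable (fun ζ => (u ζ) ^ 2) volume (-r - ξ) 0 := by
      rw [intervalIntegrable_iff_integrableOn_Ioc_of_le (by linarith [hξ.1])]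
      exact IntegrableOn.mono_set hu
        (fun ζ hζ => ⟨by linarith [hζ.1, hξ.2], hζ.2⟩)
    have hu' : IntervalIntegrable (fun ζ => (u (ζ - ξ)) ^ 2) volume (-r) ξ := by
      have := hu0.comp_sub_right ξ
      simpa using this
    have b1 : ∫ ζ in (-r)..ξ, (a ζ) ^ 2 ≤ ∫ ξ, (a ξ) ^ 2 ∂(delayMeasure r) := by
      rw [intervalIntegral.integral_of_le hξ.1]
      exact setIntegral_mono_set ha (Filter.Eventually.of_forall fun _ => sq_nonneg _)
        (Filter.Eventually.of_forall (fun ζ hζ => ⟨hζ.1.le, hζ.2.trans hξ.2⟩))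
    have b2 : ∫ ζ in (-r)..ξ, (u (ζ - ξ)) ^ 2 ≤ ∫ ξ, (u ξ) ^ 2 ∂(delayMeasure r) := by
      rw [intervalIntegral.integral_comp_sub_right (fun ζ => (u ζ) ^ 2) ξ, sub_self,
        intervalIntegral.integral_of_le (by linarith [hξ.1])]
      exact setIntegral_mono_set hu (Filter.Eventually.of_forall fun _ => sq_nonneg _)
        (Filter.Eventually.of_forall (fun ζ hζ => ⟨by linarith [hζ.1, hξ.2], hζ.2⟩))
    calc ‖delayConv a u ξ‖ ≤ ∫ ζ in (-r)..ξ, ((a ζ) ^ 2 + (u (ζ - ξ)) ^ 2) := by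
          refine intervalIntegral.norm_integral_le_of_norm_le hξ.1 ?_ (ha'.add hu')
          refine Filter.Eventually.of_forall fun ζ _ => ?_
          rw [Real.norm_eq_abs, abs_le]
          constructor <;> nlinarith [sq_nonneg (a ζ + u (ζ - ξ)), sq_nonneg (a ζ - u (ζ - ξ)),
            sq_nonneg (a ζ), sq_nonneg (u (ζ - ξ))]
      _ = _ := intervalIntegral.integral_add ha' hu'
      _ ≤ _ := add_le_add b1 b2

/-- The operator `M : X × L²([-r, 0]) → X`, `M (x₀, x₁, v) = (x₀, m)` with
`m(ξ) = ∫_{-r}^ξ a₁(ζ) x₁(ζ - ξ) dζ + ∫_{-r}^ξ b₁(ζ) v(ζ - ξ) dζ`. -/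
def opM {r : ℝ} (a₁ b₁ : L2 r) (x : X r) (v : L2 r) : X r :=
  mkX x.fst (MemLp.toLp (fun ξ => delayConv a₁ x.snd ξ + delayConv b₁ v ξ)
    ((memLp_delayConv a₁ x.snd).add (memLp_delayConv b₁ v)))

/-! ### Filtration, controls, solutions -/

section Stochastic

variable {Ω : Type*} [mΩ : MeasurableSpace Ω]

/-- The filtration generated by `W`, completed by the `P`-null events. -/
def completedFiltration (P : Measure Ω) (W : ℝ≥0 → Ω → ℝ) (hW : ∀ t, Measurable (W t)) :
    Filtration ℝ≥0 mΩ where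
  seq t := (⨆ s ≤ t, MeasurableSpace.comap (W s) inferInstance) ⊔
    MeasurableSpace.generateFrom {N | MeasurableSet N ∧ P N = 0}
  mono' _ _ hst := sup_le_sup_right (biSup_mono fun _ h => h.trans hst) _
  le' _ := sup_le (iSup₂_le fun s _ => (hW s).comap_le)
    (MeasurableSpace.generateFrom_le fun _ hN => hN.1)

/-- The restriction of a filtration to the time interval `[0, T]`. -/
def restrictFiltration (𝓕 : Filtration ℝ≥0 mΩ) (T : ℝ≥0) : Filtration (Iic T) mΩ where
  seq t := 𝓕 (t : ℝ≥0)
  mono' _ _ hst := 𝓕.mono hst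
  le' t := 𝓕.le (t : ℝ≥0)

/-- The set `L²_𝔽([0, T]; ℝ₊)` of admissible controls: non-negative, adapted processes, square
integrable over `[0, T] × Ω`. -/
structure IsAdmissibleControl (P : Measure Ω) (𝓕 : Filtration ℝ≥0 mΩ) (T : ℝ≥0)
    (z : ℝ → Ω → ℝ) : Prop where
  nonneg : ∀ t ∈ Icc (0 : ℝ) T, ∀ ω, 0 ≤ z t ω
  adapted : ∀ t : ℝ≥0, t ≤ T → Measurable[𝓕 t] (z t)
  memLp : MemLp (Function.uncurry z) 2 ((volume.restrict (Icc (0 : ℝ) T)).prod P)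

/-- `f(s)` for `s ≥ 0`, with the history `h(s)` for `s < 0`. -/
def withHistory (h : ℝ → ℝ) (f : ℝ → Ω → ℝ) : ℝ → Ω → ℝ :=
  fun s ω => if s < 0 then h s else f s ω

/-- Weak solution on `[0, T]`, with initial datum `x`, of the Hilbert space equation
`dY(s) = (A Y(s) + B z(s)) ds + G dW(s)`, where `Astar` is the adjoint of `A`:
a predictable process `Y` with a.s. Bochner integrable trajectories such that, for every
`ζ ∈ D(A*)` and every `t ∈ [0, T]`, almost surely
`⟪Y(t), ζ⟫ = ⟪x, ζ⟫ + ∫_0^t (⟪Y(s), A* ζ⟫ + ⟪B z(s), ζ⟫) ds + ⟪G W(t), ζ⟫`. -/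
structure IsWeakSolution {H : Type*} [NormedAddCommGroup H] [InnerProductSpace ℝ H]
    (P : Measure Ω) (𝓕 : Filtration ℝ≥0 mΩ) (T : ℝ≥0) (W : ℝ≥0 → Ω → ℝ)
    (Astar : H →ₗ.[ℝ] H) (B G : ℝ →L[ℝ] H) (z : ℝ → Ω → ℝ) (x : H) (Y : ℝ → Ω → H) : Prop where
  predictable : IsStronglyPredictable (restrictFiltration 𝓕 T)
    (fun (t : Iic T) ω => Y ((t : ℝ≥0) : ℝ) ω)
  integrable : ∀ᵐ ω ∂P, IntegrableOn (fun s => Y s ω) (Icc (0 : ℝ) T)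
  eqn : ∀ (ζ : Astar.domain) (t : ℝ≥0), t ≤ T → ∀ᵐ ω ∂P,
    ⟪Y t ω, (ζ : H)⟫_ℝ = ⟪x, (ζ : H)⟫_ℝ +
      (∫ s in (0 : ℝ)..t, (⟪Y s ω, Astar ζ⟫_ℝ + ⟪B (z s ω), (ζ : H)⟫_ℝ)) +
      ⟪G (W t ω), (ζ : H)⟫_ℝ

/-- Almost surely, the path of `Y` on `[0, T]` is continuous. -/
def HasContinuousPaths {H : Type*} [TopologicalSpace H] (P : Measure Ω) (T : ℝ≥0)
    (Y : ℝ → Ω → H) : Prop :=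
  ∀ᵐ ω ∂P, ContinuousOn (fun s => Y s ω) (Icc (0 : ℝ) T)

/-- Continuous solution `y` on `[-r, T]` of the stochastic delay differential equation
`dy(s) = [a₀ y(s) + ∫_{-r}^0 a₁(ξ) y(s+ξ) dξ + b₀ z(s) + ∫_{-r}^0 b₁(ξ) z(s+ξ) dξ] ds + σ dW(s)`
with `y(0) = η⁰` and with `y(ξ) = η(ξ)` for `ξ ∈ [-r, 0)`; here `z` is already defined on
`[-r, T]`. No compatibility `η(0) = η⁰` is required. -/
structure IsSDDESolution (P : Measure Ω) (𝓕 : Filtration ℝ≥0 mΩ) (T : ℝ≥0) (W : ℝ≥0 → Ω → ℝ)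
    {r : ℝ} (a₀ b₀ σ : ℝ) (a₁ b₁ : L2 r) (η₀ : ℝ) (η : ℝ → ℝ) (z : ℝ → Ω → ℝ)
    (y : ℝ → Ω → ℝ) : Prop where
  adapted : ∀ t : ℝ≥0, t ≤ T → Measurable[𝓕 t] (y t)
  continuous : HasContinuousPaths P T y
  initial : ∀ᵐ ω ∂P, y 0 ω = η₀
  history : ∀ᵐ ω ∂P, ∀ ξ ∈ Ico (-r) 0, y ξ ω = η ξ
  eqn : ∀ t : ℝ≥0, t ≤ T → ∀ᵐ ω ∂P, y t ω = η₀ +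
    (∫ s in (0 : ℝ)..t,
      (a₀ * y s ω + (∫ ξ in (-r)..0, a₁ ξ * y (s + ξ) ω) +
        b₀ * z s ω + ∫ ξ in (-r)..0, b₁ ξ * z (s + ξ) ω)) + σ * W t ω

end Stochastic

end DelaySDE

end

/-!
The noise enters the state equation only through the first component, so everything is proved path
by path. The graph of `A*` is separable and both sides of the weak formulation are continuous in
the time and in the test element; hence almost surely the weak formulation holds for all times and
all test elements at once (`IsWeakSolution.ae_isPathwiseWeakSolution`).

Fix such a path. The delay component formally solves the transport equation
`∂_t Y₁ + ∂_ξ Y₁ = a₁ Y₀(t) + b₁ z(t)` with `Y₁(t, -r) = 0`. The test elements `(0, (c - ξ)⁺)`,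
`c ≤ 0`, do not see the noise, and turn it into an equation for the second primitive
`Ψ(t, c) = ∫ (c - ξ)⁺ Y₁(t, ξ) dξ` with `∂_c Ψ = ∫_{-r}^c Y₁`. Integration along the characteristics
(`eq_along_characteristic`) gives `Ψ(t, c)` as `Ψ(0, c - t)` plus the integral of the source
(`hinge_snd_eq`). By Fubini's theorem this is the second primitive of the past convolutions of
`a₁` with `Y₀` and of `b₁` with `z`, as soon as `Ψ(0, ·)` is (`hinge_pastConv`), and a function is
determined by its second primitive (`ae_eq_zero_of_hinge_eq_zero`); this is
`snd_ae_eq_pastConv`. After time `r` the initial datum has left the delay interval, which gives the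
first claim; for an initial datum of the form `M(η⁰, η, δ)` the formula continues the one at
time `0`.

In the second case the test element `(1, 1)`, together with the formula for `Y₁`, shows that `Y₀`
solves the delay equation with history `η` (`fst_eq_delay_equation`). The difference with `y` solves
a linear delay equation with zero data, in which the noise has cancelled, and vanishes by
Gronwall's inequality (`eq_zero_of_delay_equation`).
-/

noncomputable section

namespace DelaySDE

/-! ### First and second primitives of an integrable function -/

/-- The primitive `c ↦ ∫_{-∞}^c v` of an integrable function. -/
def cumul (v : ℝ → ℝ) (c : ℝ) : ℝ := ∫ ξ in Iic c, v ξ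

/-- The pairing `∫ (c - ξ)⁺ v(ξ) dξ` of `v` with the hinge function at `c`. It is the second
primitive of `v`, see `hinge_sub_hinge`. -/
def hinge (v : ℝ → ℝ) (c : ℝ) : ℝ := ∫ ξ, max (c - ξ) 0 * v ξ

lemma integrable_hinge {v : ℝ → ℝ} {r : ℝ} (hv : Integrable v) (h0 : ∀ ξ < -r, v ξ = 0) (c : ℝ) :
    Integrable (fun ξ => max (c - ξ) 0 * v ξ) := by
  refine (hv.norm.const_mul (max (c + r) 0)).mono'
    ((by fun_prop : Continuous fun ξ => max (c - ξ) 0).aestronglyMeasurable.mul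
      hv.aestronglyMeasurable) (Filter.Eventually.of_forall fun ξ => ?_)
  rw [norm_mul, Real.norm_of_nonneg (le_max_right _ _)]
  rcases lt_or_ge ξ (-r) with h | h
  · simp [h0 ξ h]
  · gcongr
    linarith

lemma integral_indicator_Ici_one (ξ c c' : ℝ) :
    ∫ η in c..c', (Ici ξ).indicator (fun _ => (1 : ℝ)) η = max (c' - ξ) 0 - max (c - ξ) 0 := by
  refine integral_eq_of_hasDerivAt_off_countable (fun η => max (η - ξ) 0) _ (countable_singleton ξ)
    (by fun_prop) ?_ ?_
  · rintro η ⟨-, hη⟩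
    rcases lt_or_gt_of_ne (show η ≠ ξ from hη) with h | h
    · rw [indicator_of_notMem (by simpa using h)]
      refine (hasDerivAt_const η (0 : ℝ)).congr_of_eventuallyEq ?_
      filter_upwards [Iio_mem_nhds h] with x hx
      exact max_eq_right (by linarith [mem_Iio.1 hx])
    · rw [indicator_of_mem (by exact h.le)]
      refine ((hasDerivAt_id η).sub_const ξ).congr_of_eventuallyEq ?_
      filter_upwards [Ioi_mem_nhds h] with x hx
      exact max_eq_left (by linarith [mem_Ioi.1 hx])
  · exact ((integrable_const (μ := volume.restrict (Ioc c c')) (1 : ℝ)).indicator measurableSet_Ici |>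
      fun h1 => ⟨h1, (integrable_const (μ := volume.restrict (Ioc c' c)) (1 : ℝ)).indicator
        measurableSet_Ici⟩)

lemma hinge_sub_hinge {v : ℝ → ℝ} {r : ℝ} (hv : Integrable v) (h0 : ∀ ξ < -r, v ξ = 0)
    (c c' : ℝ) : hinge v c' - hinge v c = ∫ η in c..c', cumul v η := by
  have h1 : ∀ η, cumul v η = ∫ ξ, (Ici ξ).indicator (fun _ => (1 : ℝ)) η * v ξ := fun η => by
    rw [cumul, ← integral_indicator measurableSet_Iic]
    refine integral_congr_ae (Filter.Eventually.of_forall fun ξ => ?_)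
    by_cases h : ξ ≤ η
    · simp [h]
    · simp [h]
  simp_rw [h1]
  rw [intervalIntegral_integral_swap, hinge, hinge,
    ← integral_sub (integrable_hinge hv h0 _) (integrable_hinge hv h0 _)]
  · refine integral_congr_ae (Filter.Eventually.of_forall fun ξ => ?_)
    simp only
    rw [intervalIntegral.integral_mul_const, integral_indicator_Ici_one]
    ring
  · have : IsFiniteMeasure (volume.restrict (uIoc c c')) := by rw [uIoc]; infer_instance
    have h2 : Integrable (fun p : ℝ × ℝ => v p.2) ((volume.restrict (uIoc c c')).prod volume) :=
      hv.comp_snd _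
    refine (h2.indicator (s := {p : ℝ × ℝ | p.2 ≤ p.1})
      (measurableSet_le measurable_snd measurable_fst)).congr
      (Filter.Eventually.of_forall fun p => ?_)
    by_cases h : p.2 ≤ p.1
    · simp [h, Function.uncurry]
    · simp [h, Function.uncurry]

lemma cumul_sub_cumul {v : ℝ → ℝ} (hv : Integrable v) (c c' : ℝ) :
    cumul v c' - cumul v c = ∫ ξ in c..c', v ξ :=
  intervalIntegral.integral_Iic_sub_Iic hv.integrableOn hv.integrableOn

lemma continuous_cumul {v : ℝ → ℝ} (hv : Integrable v) : Continuous (cumul v) := by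
  have h : cumul v = fun c => cumul v 0 + ∫ ξ in (0 : ℝ)..c, v ξ := by
    ext c; rw [← cumul_sub_cumul hv]; ring
  rw [h]
  exact continuous_const.add
    (intervalIntegral.continuous_primitive (fun _ _ => hv.intervalIntegrable) 0)

lemma continuous_hinge {v : ℝ → ℝ} {r : ℝ} (hv : Integrable v) (h0 : ∀ ξ < -r, v ξ = 0) :
    Continuous (hinge v) := by
  have h : hinge v = fun c => hinge v 0 + ∫ ξ in (0 : ℝ)..c, cumul v ξ := by
    ext c; rw [← hinge_sub_hinge hv h0]; ring
  rw [h]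
  exact continuous_const.add (intervalIntegral.continuous_primitive
    (fun _ _ => (continuous_cumul hv).intervalIntegrable _ _) 0)

lemma cumul_eq_zero {v : ℝ → ℝ} {r c : ℝ} (h0 : ∀ ξ < -r, v ξ = 0) (hc : c ≤ -r) :
    cumul v c = 0 := by
  rw [cumul, integral_Iic_eq_integral_Iio]
  exact setIntegral_eq_zero_of_forall_eq_zero fun ξ hξ => h0 ξ (lt_of_lt_of_le hξ hc)

lemma hinge_eq_zero {v : ℝ → ℝ} {r c : ℝ} (h0 : ∀ ξ < -r, v ξ = 0) (hc : c ≤ -r) :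
    hinge v c = 0 := by
  refine integral_eq_zero_of_ae (Filter.Eventually.of_forall fun ξ => ?_)
  rcases lt_or_ge ξ (-r) with h | h
  · simp [h0 ξ h]
  · simp [max_eq_right (show c - ξ ≤ 0 by linarith)]

lemma hinge_sub {v w : ℝ → ℝ} {r : ℝ} (hv : Integrable v) (h0 : ∀ ξ < -r, v ξ = 0)
    (hw : Integrable w) (h0' : ∀ ξ < -r, w ξ = 0) (c : ℝ) :
    hinge (fun ξ => v ξ - w ξ) c = hinge v c - hinge w c := by
  rw [hinge, hinge, hinge, ← integral_sub (integrable_hinge hv h0 c) (integrable_hinge hw h0' c)]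
  simp_rw [mul_sub]

lemma hinge_add {v w : ℝ → ℝ} {r : ℝ} (hv : Integrable v) (h0 : ∀ ξ < -r, v ξ = 0)
    (hw : Integrable w) (h0' : ∀ ξ < -r, w ξ = 0) (c : ℝ) :
    hinge (fun ξ => v ξ + w ξ) c = hinge v c + hinge w c := by
  rw [hinge, hinge, hinge, ← integral_add (integrable_hinge hv h0 c) (integrable_hinge hw h0' c)]
  simp_rw [mul_add]

/-- A function on `[-r, 0]` is determined by its pairings with the hinge functions: differentiating
`hinge v` twice recovers `v`. -/
lemma ae_eq_zero_of_hinge_eq_zero {v : ℝ → ℝ} {r : ℝ} (hv : Integrable v)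
    (h0 : ∀ ξ < -r, v ξ = 0) (h : ∀ c ∈ Icc (-r) 0, hinge v c = 0) :
    ∀ᵐ ξ, ξ ∈ Icc (-r) 0 → v ξ = 0 := by
  have hd : ∀ c, HasDerivAt (hinge v) (cumul v c) c := fun c => by
    have h1 : hinge v = fun c => hinge v 0 + ∫ ξ in (0 : ℝ)..c, cumul v ξ := by
      ext c; rw [← hinge_sub_hinge hv h0]; ring
    rw [h1]
    exact (intervalIntegral.integral_hasDerivAt_right
      ((continuous_cumul hv).intervalIntegrable _ _)
      (continuous_cumul hv).aestronglyMeasurable.stronglyMeasurableAtFilter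
      (continuous_cumul hv).continuousAt).const_add _
  have h1 : ∀ c ∈ Ioo (-r) 0, cumul v c = 0 := fun c hc => by
    refine (hd c).unique ((hasDerivAt_const c (0 : ℝ)).congr_of_eventuallyEq ?_)
    filter_upwards [isOpen_Ioo.mem_nhds hc] with x hx
    exact h x (Ioo_subset_Icc_self hx)
  filter_upwards [LocallyIntegrable.ae_hasDerivAt_integral hv.locallyIntegrable,
    Measure.ae_ne volume (-r), Measure.ae_ne volume (0 : ℝ)] with ξ hξ hne hne' hmem
  have hmem' : ξ ∈ Ioo (-r) 0 :=
    ⟨lt_of_le_of_ne hmem.1 hne.symm, lt_of_le_of_ne hmem.2 hne'⟩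
  refine (hξ ξ).unique ((hasDerivAt_const ξ (0 : ℝ)).congr_of_eventuallyEq ?_)
  filter_upwards [isOpen_Ioo.mem_nhds hmem'] with x hx
  rw [← cumul_sub_cumul hv, h1 x hx, h1 ξ hmem', sub_zero]

/-! ### Delay convolutions -/

/-- The convolution `ξ ↦ ∫_{-∞}^ξ a(ζ) h(t + ζ - ξ) dζ` of a kernel `a` with the past of `h`
before time `t`. -/
def pastConv (a h : ℝ → ℝ) (t ξ : ℝ) : ℝ := ∫ ζ in Iic ξ, a ζ * h (t + ζ - ξ)

lemma integrable_pastConv_integrand {a h : ℝ → ℝ} (ha : Integrable a) (hh : Integrable h) (t : ℝ) :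
    Integrable (fun p : ℝ × ℝ => (Iic p.1).indicator (fun ζ => a ζ * h (t + ζ - p.1)) p.2)
      (volume.prod volume) := by
  have h1 : Integrable (fun p : ℝ × ℝ => a p.2 * h (t - (p.1 - p.2))) (volume.prod volume) :=
    ha.convolution_integrand (ContinuousLinearMap.mul ℝ ℝ) (hh.comp_sub_left t)
  refine (h1.indicator (s := {p : ℝ × ℝ | p.2 ≤ p.1})
      (measurableSet_le measurable_snd measurable_fst)).congr
      (Filter.Eventually.of_forall fun p => ?_)
  by_cases h : p.2 ≤ p.1
  · simp [h, sub_sub_eq_add_sub]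
  · simp [h]

lemma pastConv_eq_integral (a h : ℝ → ℝ) (t ξ : ℝ) :
    pastConv a h t ξ = ∫ ζ, (Iic ξ).indicator (fun ζ => a ζ * h (t + ζ - ξ)) ζ :=
  (integral_indicator measurableSet_Iic).symm

lemma integrable_pastConv {a h : ℝ → ℝ} (ha : Integrable a) (hh : Integrable h) (t : ℝ) :
    Integrable (pastConv a h t) := by
  have := (integrable_pastConv_integrand ha hh t).integral_prod_left
  refine this.congr (Filter.Eventually.of_forall fun ξ => ?_)
  simp only
  rw [pastConv_eq_integral]

lemma pastConv_eq_zero {a h : ℝ → ℝ} {r : ℝ} (h0 : ∀ ξ < -r, a ξ = 0) (t : ℝ) {ξ : ℝ}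
    (hξ : ξ < -r) : pastConv a h t ξ = 0 :=
  setIntegral_eq_zero_of_forall_eq_zero fun ζ hζ => by
    rw [h0 ζ (lt_of_le_of_lt hζ hξ), zero_mul]

/-- Fubini's theorem for the pairing of a past convolution with a bounded weight `p`. -/
lemma integral_mul_pastConv {a h p : ℝ → ℝ} (ha : Integrable a) (hh : Integrable h)
    (hp : Measurable p) {K : ℝ} (hK : ∀ ξ, |p ξ| ≤ K) (t : ℝ) :
    ∫ ξ, p ξ * pastConv a h t ξ = ∫ ζ, a ζ * ∫ u in Iic t, p (t + ζ - u) * h u := by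
  have hint : Integrable (fun q : ℝ × ℝ =>
      p q.1 * (Iic q.1).indicator (fun ζ => a ζ * h (t + ζ - q.1)) q.2) (volume.prod volume) :=
    (integrable_pastConv_integrand ha hh t).bdd_mul
      (hp.comp measurable_fst).aestronglyMeasurable
      (Filter.Eventually.of_forall fun q => hK q.1)
  simp_rw [pastConv_eq_integral, ← integral_const_mul]
  rw [integral_integral_swap hint]
  refine integral_congr_ae (Filter.Eventually.of_forall fun ζ => ?_)
  simp only
  rw [← integral_indicator measurableSet_Iic,
    ← integral_sub_left_eq_self (fun ξ => p ξ * _) volume (t + ζ)]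
  refine integral_congr_ae (Filter.Eventually.of_forall fun u => ?_)
  by_cases hu : u ≤ t
  · have h1 : ζ ≤ t + ζ - u := by linarith
    simp [hu, h1]; ring
  · have h1 : ¬ ζ ≤ t + ζ - u := by linarith
    simp [hu, h1]

/-- The second primitive of a past convolution is the convolution of `h` with the second primitive
of the kernel. -/
lemma hinge_pastConv {a h : ℝ → ℝ} {r : ℝ} (ha : Integrable a) (h0 : ∀ ξ < -r, a ξ = 0)
    (hh : Integrable h) (t c : ℝ) :
    hinge (pastConv a h t) c = ∫ u in Iic t, hinge a (c - t + u) * h u := by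
  -- The hinge function is truncated below `-r` to make it bounded.
  set p : ℝ → ℝ := (Ici (-r)).indicator fun ξ => max (c - ξ) 0 with hpdef
  have hp : Measurable p := (by fun_prop : Continuous fun ξ => max (c - ξ) 0).measurable.indicator
    measurableSet_Ici
  have hK : ∀ ξ, |p ξ| ≤ max (c + r) 0 := fun ξ => by
    by_cases hξ : -r ≤ ξ
    · rw [hpdef, indicator_of_mem (mem_Ici.2 hξ), abs_of_nonneg (le_max_right _ _)]
      gcongr; linarith
    · simp [hpdef, hξ]
  have e1 : hinge (pastConv a h t) c = ∫ ξ, p ξ * pastConv a h t ξ := by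
    refine integral_congr_ae (Filter.Eventually.of_forall fun ξ => ?_)
    by_cases hξ : -r ≤ ξ
    · simp [hpdef, hξ]
    · simp [pastConv_eq_zero h0 t (not_le.1 hξ)]
  rw [e1, integral_mul_pastConv ha hh hp hK]
  simp_rw [← integral_const_mul]
  rw [integral_integral_swap]
  · refine setIntegral_congr_fun measurableSet_Iic fun u hu => ?_
    rw [hinge, ← integral_mul_const]
    refine integral_congr_ae (Filter.Eventually.of_forall fun ζ => ?_)
    simp only
    by_cases hζ : ζ < -r
    · simp [h0 ζ hζ]
    · have : -r ≤ t + ζ - u := by linarith [mem_Iic.1 hu]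
      rw [hpdef, indicator_of_mem (mem_Ici.2 this), show c - (t + ζ - u) = c - t + u - ζ by ring]
      ring
  · have h1 : Integrable (fun q : ℝ × ℝ => a q.1 * h q.2)
        (volume.prod (volume.restrict (Iic t))) := ha.mul_prod hh.integrableOn
    refine (h1.bdd_mul (f := fun q : ℝ × ℝ => p (t + q.1 - q.2)) (c := max (c + r) 0)
      (hp.comp (by fun_prop)).aestronglyMeasurable
      (Filter.Eventually.of_forall fun q => hK _)).congr
      (Filter.Eventually.of_forall fun q => ?_)
    simp only [Function.uncurry]
    ring

/-! ### The transport equation -/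

/-- Fubini's theorem on the triangle `0 ≤ u ≤ s ≤ t`. -/
lemma intervalIntegral_triangle_swap {F : ℝ → ℝ → ℝ} {G : ℝ → ℝ} {t : ℝ} (ht : 0 ≤ t)
    (hFm : StronglyMeasurable (Function.uncurry F)) (hG : Integrable G)
    (hF : ∀ u s, 0 ≤ u → u ≤ s → s ≤ t → |F u s| ≤ G u) :
    IntervalIntegrable (fun s => ∫ u in (0 : ℝ)..s, F u s) volume 0 t ∧
    IntervalIntegrable (fun u => ∫ s in u..t, F u s) volume 0 t ∧
    ∫ s in (0 : ℝ)..t, ∫ u in (0 : ℝ)..s, F u s = ∫ u in (0 : ℝ)..t, ∫ s in u..t, F u s := by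
  set D : Set (ℝ × ℝ) := {p | p.1 < p.2} with hD
  have hDm : MeasurableSet D := measurableSet_lt measurable_fst measurable_snd
  have hint : Integrable (D.indicator (Function.uncurry F))
      ((volume.restrict (Ioc 0 t)).prod (volume.restrict (Ioc 0 t))) := by
    have hG' : Integrable (fun p : ℝ × ℝ => G p.1)
      ((volume.restrict (Ioc 0 t)).prod (volume.restrict (Ioc 0 t))) := hG.integrableOn.comp_fst _
    refine hG'.mono' (hFm.indicator hDm).aestronglyMeasurable ?_
    rw [Measure.prod_restrict]
    filter_upwards [ae_restrict_mem (measurableSet_Ioc.prod measurableSet_Ioc)] with p hp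
    have hG0 : 0 ≤ G p.1 := (abs_nonneg _).trans (hF p.1 p.1 hp.1.1.le le_rfl hp.1.2)
    by_cases h : p ∈ D
    · rw [indicator_of_mem h]
      exact hF p.1 p.2 hp.1.1.le (le_of_lt h) hp.2.2
    · rw [indicator_of_notMem h, norm_zero]
      exact hG0
  have e1 : ∀ s ∈ Ioc 0 t, ∫ u in (0 : ℝ)..s, F u s =
      ∫ u in Ioc 0 t, D.indicator (Function.uncurry F) (u, s) := fun s hs => by
    rw [intervalIntegral.integral_of_le hs.1.le, integral_Ioc_eq_integral_Ioo]
    have : ∀ u, D.indicator (Function.uncurry F) (u, s) = (Iio s).indicator (fun u => F u s) u :=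
      fun u => by by_cases h : u < s <;> simp [hD, h, Function.uncurry]
    simp_rw [this]
    rw [setIntegral_indicator measurableSet_Iio]
    congr 2
    ext u; constructor
    · exact fun h => ⟨⟨h.1, h.2.le.trans hs.2⟩, h.2⟩
    · exact fun h => ⟨h.1.1, h.2⟩
  have e2 : ∀ u ∈ Ioc 0 t, ∫ s in u..t, F u s =
      ∫ s in Ioc 0 t, D.indicator (Function.uncurry F) (u, s) := fun u hu => by
    rw [intervalIntegral.integral_of_le hu.2]
    have : ∀ s, D.indicator (Function.uncurry F) (u, s) = (Ioi u).indicator (fun s => F u s) s :=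
      fun s => by by_cases h : u < s <;> simp [hD, h, Function.uncurry]
    simp_rw [this]
    rw [setIntegral_indicator measurableSet_Ioi]
    congr 2
    ext s; constructor
    · exact fun h => ⟨⟨hu.1.trans h.1, h.2⟩, h.1⟩
    · exact fun h => ⟨h.2, h.1.2⟩
  refine ⟨?_, ?_, ?_⟩
  · rw [intervalIntegrable_iff_integrableOn_Ioc_of_le ht]
    exact (integrableOn_congr_fun e1 measurableSet_Ioc).2 hint.integral_prod_right
  · rw [intervalIntegrable_iff_integrableOn_Ioc_of_le ht]
    exact (integrableOn_congr_fun e2 measurableSet_Ioc).2 hint.integral_prod_left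
  · rw [intervalIntegral.integral_of_le ht, intervalIntegral.integral_of_le ht,
      setIntegral_congr_fun measurableSet_Ioc e1, setIntegral_congr_fun measurableSet_Ioc e2]
    exact integral_integral_swap (f := fun s u => D.indicator (Function.uncurry F) (u, s)) hint.swap

lemma eqOn_of_intervalIntegral_eq {f g : ℝ → ℝ} {T : ℝ} (hT : 0 < T)
    (hf : ContinuousOn f (Icc 0 T)) (hg : ContinuousOn g (Icc 0 T))
    (h : ∀ t ∈ Icc 0 T, ∫ s in (0 : ℝ)..t, f s = ∫ s in (0 : ℝ)..t, g s) :
    EqOn f g (Icc 0 T) := by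
  have key : ∀ {f : ℝ → ℝ}, ContinuousOn f (Icc 0 T) → ∀ t ∈ Ioo 0 T,
      HasDerivAt (fun t => ∫ s in (0 : ℝ)..t, f s) (f t) t := fun {f} hf t ht => by
    have hc : ContinuousOn f (uIcc 0 t) := by
      rw [uIcc_of_le ht.1.le]; exact hf.mono (Icc_subset_Icc_right ht.2.le)
    refine intervalIntegral.integral_hasDerivAt_right hc.intervalIntegrable ?_
      (hf.continuousAt (Icc_mem_nhds ht.1 ht.2))
    exact (hf.mono Ioo_subset_Icc_self).stronglyMeasurableAtFilter isOpen_Ioo _ ht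
  have hIoo : EqOn f g (Ioo 0 T) := fun t ht => by
    refine (key hf t ht).unique ((key hg t ht).congr_of_eventuallyEq ?_)
    filter_upwards [isOpen_Ioo.mem_nhds ht] with s hs
    exact h s (Ioo_subset_Icc_self hs)
  refine hIoo.of_subset_closure hf hg Ioo_subset_Icc_self ?_
  rw [closure_Ioo hT.ne]

lemma continuousOn_integral_along_characteristic {g : ℝ → ℝ → ℝ} {G : ℝ → ℝ} {c T : ℝ}
    (hc : c ≤ 0) (hgm : StronglyMeasurable (Function.uncurry g)) (hgc : ∀ u, Continuous (g u))
    (hG : Integrable G) (hg : ∀ u, ∀ c ≤ 0, |g u c| ≤ G u) :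
    ContinuousOn (fun t => ∫ u in (0 : ℝ)..t, g u (c - t + u)) (Icc 0 T) := by
  have e : ∀ t ∈ Icc 0 T, ∫ u in (0 : ℝ)..t, g u (c - t + u) =
      ∫ u in Ioi 0, (Iic t).indicator (fun u => g u (c - t + u)) u := fun t ht => by
    rw [intervalIntegral.integral_of_le ht.1, setIntegral_indicator measurableSet_Iic,
      Ioi_inter_Iic]
  refine ContinuousOn.congr (fun t₀ ht₀ => ?_) e
  refine continuousWithinAt_of_dominated (bound := G) ?_ ?_ hG.integrableOn ?_
  · refine Filter.Eventually.of_forall fun t => StronglyMeasurable.aestronglyMeasurable ?_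
    exact (hgm.comp_measurable (g := fun u => (u, c - t + u)) (by fun_prop)).indicator
      measurableSet_Iic
  · refine Filter.Eventually.of_forall fun t => Filter.Eventually.of_forall fun u => ?_
    by_cases h : u ≤ t
    · rw [indicator_of_mem (mem_Iic.2 h)]
      exact hg u _ (by linarith)
    · rw [indicator_of_notMem (by simpa using h), norm_zero]
      exact (abs_nonneg _).trans (hg u 0 le_rfl)
  · filter_upwards [ae_restrict_of_ae (Measure.ae_ne volume t₀)] with u hu
    refine ContinuousAt.continuousWithinAt ?_
    rcases lt_or_gt_of_ne hu with h | h
    · refine ContinuousAt.congr (f := fun t => g u (c - t + u)) ?_ ?_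
      · exact ((hgc u).comp (by fun_prop)).continuousAt
      · filter_upwards [Ioi_mem_nhds h] with t ht
        rw [indicator_of_mem (mem_Iic.2 (le_of_lt ht))]
    · refine ContinuousAt.congr (f := fun _ => 0) continuousAt_const ?_
      filter_upwards [Iio_mem_nhds h] with t ht
      rw [indicator_of_notMem (by simpa using ht)]

/-- Integrated form of the method of characteristics. If `Φ = ∂_c Ψ` and
`∂_t Ψ = - Φ + g` in integrated form, then `Ψ` is transported to the right with unit speed, up to
the source `g`. Integrating the equation along the characteristic through `(t, c)` gives two
integrals of `Φ` over the triangle between the characteristic and the sides through `(t, c)`;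
they cancel by Fubini's theorem, so that no regularity of `Φ` is needed. -/
theorem eq_along_characteristic {Φ Ψ g : ℝ → ℝ → ℝ} {G : ℝ → ℝ} {T K : ℝ} (hT : 0 < T)
    (hΦm : StronglyMeasurable (Function.uncurry Φ)) (hΦ : ∀ s ∈ Icc 0 T, ∀ c, |Φ s c| ≤ K)
    (hgm : StronglyMeasurable (Function.uncurry g)) (hgc : ∀ u, Continuous (g u))
    (hG : Integrable G) (hg : ∀ u, ∀ c ≤ 0, |g u c| ≤ G u)
    (hΨt : ∀ c, Continuous fun t => Ψ t c) (hΨ0 : Continuous (Ψ 0))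
    (hΨΦ : ∀ s c c', Ψ s c' - Ψ s c = ∫ η in c..c', Φ s η)
    (heq : ∀ t ∈ Icc 0 T, ∀ c ≤ 0, Ψ t c = Ψ 0 c - (∫ s in (0 : ℝ)..t, Φ s c) +
      ∫ s in (0 : ℝ)..t, g s c) :
    ∀ t ∈ Icc 0 T, ∀ c ≤ 0, Ψ t c = Ψ 0 (c - t) + ∫ u in (0 : ℝ)..t, g u (c - t + u) := by
  intro t₁ ht₁ c hc
  have hq := continuousOn_integral_along_characteristic (T := T) hc hgm hgc hG hg
  refine eqOn_of_intervalIntegral_eq hT (f := fun t => Ψ t c)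
    (g := fun t => Ψ 0 (c - t) + ∫ u in (0 : ℝ)..t, g u (c - t + u))
    (hΨt c).continuousOn (((hΨ0.comp (by fun_prop)).continuousOn).add hq) ?_ ht₁
  intro t ht
  have hqi : IntervalIntegrable (fun t => ∫ u in (0 : ℝ)..t, g u (c - t + u)) volume 0 t := by
    refine ContinuousOn.intervalIntegrable ?_
    rw [uIcc_of_le ht.1]; exact hq.mono (Icc_subset_Icc_right ht.2)
  -- The three triangle integrals.
  obtain ⟨i1, i2, e1⟩ := intervalIntegral_triangle_swap (F := fun u s => Φ u (c - t + s))
    (G := (Icc 0 T).indicator fun _ => K) ht.1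
    (hΦm.comp_measurable (g := fun p : ℝ × ℝ => (p.1, c - t + p.2)) (by fun_prop))
    ((integrableOn_const (by simp)).integrable_indicator measurableSet_Icc)
    (fun u s hu hus hst => by
      have : u ∈ Icc 0 T := ⟨hu, hus.trans (hst.trans ht.2)⟩
      rw [indicator_of_mem this]; exact hΦ u this _)
  obtain ⟨i3, i4, e3⟩ := intervalIntegral_triangle_swap (F := fun u s => g u (c - t + s))
    ht.1 (hgm.comp_measurable (g := fun p : ℝ × ℝ => (p.1, c - t + p.2)) (by fun_prop)) hG
    (fun u s _ _ hst => hg u _ (by linarith))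
  obtain ⟨-, -, e4⟩ := intervalIntegral_triangle_swap (F := fun u s => g u (c - s + u))
    ht.1 (hgm.comp_measurable (g := fun p : ℝ × ℝ => (p.1, c - p.2 + p.1)) (by fun_prop)) hG
    (fun u s _ hus _ => hg u _ (by linarith))
  -- The equation at the point `(s, c - t + s)` of the characteristic.
  have hchar : ∀ s ∈ Icc 0 t, Ψ s c = Ψ 0 (c - t + s) + (∫ σ in s..t, Φ s (c - t + σ)) -
      (∫ u in (0 : ℝ)..s, Φ u (c - t + s)) + ∫ u in (0 : ℝ)..s, g u (c - t + s) := fun s hs => by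
    have h1 := heq s ⟨hs.1, hs.2.trans ht.2⟩ (c - t + s) (by linarith [hs.2])
    have h2 := hΨΦ s (c - t + s) c
    have h3 : ∫ σ in s..t, Φ s (c - t + σ) = ∫ η in (c - t + s)..c, Φ s η := by
      rw [intervalIntegral.integral_comp_add_left (fun η => Φ s η) (c - t)]
      congr 1; ring
    rw [h3]; linarith
  have i0 : IntervalIntegrable (fun s => Ψ 0 (c - t + s)) volume 0 t :=
    (hΨ0.comp (by fun_prop)).intervalIntegrable _ _
  calc ∫ s in (0 : ℝ)..t, Ψ s c
      = ∫ s in (0 : ℝ)..t, (Ψ 0 (c - t + s) + (∫ σ in s..t, Φ s (c - t + σ)) -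
        (∫ u in (0 : ℝ)..s, Φ u (c - t + s)) + ∫ u in (0 : ℝ)..s, g u (c - t + s)) := by
        refine intervalIntegral.integral_congr fun s hs => ?_
        rw [uIcc_of_le ht.1] at hs
        exact hchar s hs
    _ = (∫ s in (0 : ℝ)..t, Ψ 0 (c - t + s)) +
        ∫ s in (0 : ℝ)..t, ∫ u in (0 : ℝ)..s, g u (c - t + s) := by
        rw [intervalIntegral.integral_add ((i0.add i2).sub i1) i3,
          intervalIntegral.integral_sub (i0.add i2) i1, intervalIntegral.integral_add i0 i2, e1]
        ring
    _ = (∫ s in (0 : ℝ)..t, Ψ 0 (c - s)) +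
        ∫ s in (0 : ℝ)..t, ∫ u in (0 : ℝ)..s, g u (c - s + u) := by
        rw [e3, e4]
        congr 1
        · have := intervalIntegral.integral_comp_sub_left (a := 0) (b := t)
            (fun s => Ψ 0 (c - s)) t
          simp only [sub_self, sub_zero] at this
          rw [← this]
          refine intervalIntegral.integral_congr fun s _ => ?_
          congr 1; ring
        · refine intervalIntegral.integral_congr fun u _ => ?_
          have := intervalIntegral.integral_comp_sub_left (a := u) (b := t)
            (fun s => g u (c - s + u)) (t + u)
          simp only [add_sub_cancel_left, add_sub_cancel_right] at this
          rw [← this]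
          refine intervalIntegral.integral_congr fun s _ => ?_
          congr 1; ring
    _ = _ := by
        have i5 : IntervalIntegrable (fun s => Ψ 0 (c - s)) volume 0 t :=
          (hΨ0.comp (by fun_prop)).intervalIntegrable _ _
        rw [intervalIntegral.integral_add i5 hqi]

/-! ### Test elements of the domain of the adjoint -/

/-- Extension by zero of a function on the delay interval `[-r, 0]`. -/
def zeroExt (r : ℝ) (u : ℝ → ℝ) : ℝ → ℝ := (Icc (-r) 0).indicator u

lemma zeroExt_of_lt {r : ℝ} (u : ℝ → ℝ) : ∀ ξ < -r, zeroExt r u ξ = 0 := fun _ hξ =>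
  indicator_of_notMem (fun h => absurd h.1 (not_le.2 hξ)) _

lemma zeroExt_of_mem {r : ℝ} (u : ℝ → ℝ) {ξ : ℝ} (h : ξ ∈ Icc (-r) 0) : zeroExt r u ξ = u ξ :=
  indicator_of_mem h _

lemma integral_mul_zeroExt {r : ℝ} (p u : ℝ → ℝ) :
    ∫ ξ, p ξ * zeroExt r u ξ = ∫ ξ, p ξ * u ξ ∂(delayMeasure r) := by
  rw [← integral_indicator measurableSet_Icc]
  refine integral_congr_ae (Filter.Eventually.of_forall fun ξ => ?_)
  by_cases h : ξ ∈ Icc (-r) 0 <;> simp [zeroExt, h]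

lemma integrable_zeroExt {r : ℝ} (u : L2 r) : Integrable (zeroExt r u) :=
  IntegrableOn.integrable_indicator ((Lp.memLp u).integrable (by norm_num)) measurableSet_Icc

lemma abs_hinge_le {v : ℝ → ℝ} {r c : ℝ} (hr : 0 < r) (hv : Integrable v)
    (h0 : ∀ ξ < -r, v ξ = 0) (hc : c ≤ 0) : |hinge v c| ≤ r * ∫ ξ, |v ξ| := by
  rw [hinge, ← integral_const_mul]
  refine norm_integral_le_of_norm_le (f := fun ξ => max (c - ξ) 0 * v ξ) (hv.abs.const_mul r)
    (Filter.Eventually.of_forall fun ξ => ?_)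
  rw [norm_mul, Real.norm_of_nonneg (le_max_right _ _)]
  rcases lt_or_ge ξ (-r) with h | h
  · simp [h0 ξ h]
  · exact mul_le_mul_of_nonneg_right (max_le (by linarith) hr.le) (norm_nonneg _)

lemma memLp_of_bounded {r : ℝ} {p : ℝ → ℝ} (hp : Measurable p) {K : ℝ}
    (hK : ∀ ξ ∈ Icc (-r) 0, |p ξ| ≤ K) : MemLp p 2 (delayMeasure r) :=
  MemLp.of_bound hp.aestronglyMeasurable K
    ((ae_restrict_mem measurableSet_Icc).mono fun ξ hξ => hK ξ hξ)

lemma memLp_hinge (r c : ℝ) : MemLp (fun ξ => max (c - ξ) 0) 2 (delayMeasure r) :=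
  memLp_of_bounded (by fun_prop) (K := max (c + r) 0) fun ξ hξ => by
    rw [abs_of_nonneg (le_max_right _ _)]
    gcongr; linarith [hξ.1]

lemma memLp_indicator_Iic (r c : ℝ) :
    MemLp ((Iic c).indicator fun _ => (1 : ℝ)) 2 (delayMeasure r) :=
  memLp_of_bounded (measurable_const.indicator measurableSet_Iic) (K := 1) fun ξ _ => by
    by_cases h : ξ ≤ c <;> simp [h]

/-- The hinge function `ξ ↦ (c - ξ)⁺` as an element of `L²([-r, 0])`. -/
def hingeL2 (r c : ℝ) : L2 r := (memLp_hinge r c).toLp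

/-- The step function `1_{(-∞, c]}` as an element of `L²([-r, 0])`. -/
def stepL2 (r c : ℝ) : L2 r := (memLp_indicator_Iic r c).toLp

lemma inner_toLp {r : ℝ} (u : L2 r) {p : ℝ → ℝ} (hp : MemLp p 2 (delayMeasure r)) :
    ⟪u, hp.toLp⟫_ℝ = ∫ ξ, p ξ * zeroExt r u ξ := by
  rw [integral_mul_zeroExt, L2.inner_def]
  refine integral_congr_ae ?_
  filter_upwards [hp.coeFn_toLp] with ξ h
  simp [h]

lemma inner_hingeL2 {r : ℝ} (u : L2 r) (c : ℝ) : ⟪u, hingeL2 r c⟫_ℝ = hinge (zeroExt r u) c :=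
  inner_toLp u _

lemma inner_stepL2 {r : ℝ} (u : L2 r) (c : ℝ) : ⟪u, stepL2 r c⟫_ℝ = cumul (zeroExt r u) c := by
  rw [stepL2, inner_toLp, cumul, ← integral_indicator measurableSet_Iic]
  refine integral_congr_ae (Filter.Eventually.of_forall fun ξ => ?_)
  by_cases h : ξ ≤ c <;> simp [h]

lemma isW12_hinge (r c : ℝ) :
    IsW12 (hingeL2 r c) (-stepL2 r c) (fun ξ => max (c - ξ) 0) where
  ac := by
    refine LipschitzOnWith.absolutelyContinuousOnInterval (K := 1) (LipschitzWith.lipschitzOnWith ?_)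
    refine LipschitzWith.of_dist_le_mul fun x y => ?_
    rw [NNReal.coe_one, one_mul, Real.dist_eq, Real.dist_eq]
    refine (abs_max_sub_max_le_abs _ _ _).trans ?_
    rw [sub_sub_sub_cancel_left, abs_sub_comm]
  rep := (memLp_hinge r c).coeFn_toLp
  weakDeriv := by
    filter_upwards [Lp.coeFn_neg (stepL2 r c), (memLp_indicator_Iic r c).coeFn_toLp,
      ae_restrict_of_ae (Measure.ae_ne volume c)] with ξ h1 h2 hne
    rw [h1, Pi.neg_apply, stepL2, h2]
    rcases lt_or_gt_of_ne hne with h | h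
    · rw [indicator_of_mem (mem_Iic.2 h.le)]
      refine (HasDerivAt.deriv ?_).symm
      refine ((hasDerivAt_id ξ).const_sub c).congr_of_eventuallyEq ?_
      filter_upwards [Iio_mem_nhds h] with x hx
      exact max_eq_left (by simpa using (mem_Iio.1 hx).le)
    · rw [indicator_of_notMem (by simpa using h), neg_zero]
      refine (HasDerivAt.deriv ?_).symm
      refine (hasDerivAt_const ξ (0 : ℝ)).congr_of_eventuallyEq ?_
      filter_upwards [Ioi_mem_nhds h] with x hx
      exact max_eq_right (by linarith [mem_Ioi.1 hx])

lemma integral_mul_eq_inner {r : ℝ} (a u : L2 r) :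
    ∫ ξ, a ξ * u ξ ∂(delayMeasure r) = ⟪a, u⟫_ℝ := by
  rw [L2.inner_def]
  refine integral_congr_ae (Filter.Eventually.of_forall fun ξ => ?_)
  simp [mul_comm]

lemma hinge_mem_graph_opAStar {r : ℝ} (hr : 0 < r) (a₀ : ℝ) (a₁ : L2 r) {c : ℝ} (hc : c ≤ 0) :
    (mkX 0 (hingeL2 r c), mkX (hinge (zeroExt r a₁) c) (-stepL2 r c)) ∈
      (opAStar a₀ a₁).graph := by
  rw [mem_graph_opAStar_iff hr]
  refine ⟨_, _, isW12_hinge r c, by simp [hc], ?_⟩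
  rw [integral_mul_eq_inner]
  simp only [WithLp.toLp_fst, WithLp.toLp_snd, mul_zero, zero_add]
  rw [inner_hingeL2]

lemma const_mem_graph_opAStar {r : ℝ} (hr : 0 < r) (a₀ : ℝ) (a₁ : L2 r) :
    (mkX 1 (stepL2 r 0), mkX (a₀ + ∫ ξ, zeroExt r a₁ ξ) (0 : L2 r)) ∈ (opAStar a₀ a₁).graph := by
  rw [mem_graph_opAStar_iff hr]
  refine ⟨0, fun _ => 1, ⟨?_, ?_, ?_⟩, rfl, ?_⟩
  · exact LipschitzOnWith.absolutelyContinuousOnInterval (K := 0) (by intro x _ y _; simp)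
  · filter_upwards [(memLp_indicator_Iic r 0).coeFn_toLp, ae_restrict_mem measurableSet_Icc]
      with ξ h hξ
    simp only [WithLp.toLp_snd]
    rw [stepL2, h, indicator_of_mem (mem_Iic.2 hξ.2)]
  · filter_upwards [Lp.coeFn_zero ℝ 2 (delayMeasure r)] with ξ h
    rw [h]; simp
  · rw [integral_mul_eq_inner]
    simp only [WithLp.toLp_fst, WithLp.toLp_snd, mul_one]
    rw [inner_stepL2, cumul, ← integral_indicator measurableSet_Iic]
    congr 3
    ext ξ
    by_cases h : ξ ≤ 0
    · simp [h]
    · simp [h, zeroExt]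

/-! ### The components of a weak solution, path by path -/

/-- The weak formulation of the state equation along one path `Y`, for all test elements and all
times of `[0, T]`. -/
def IsPathwiseWeakSolution {r : ℝ} (a₀ b₀ σ : ℝ) (a₁ b₁ : L2 r) (T : ℝ) (z w : ℝ → ℝ) (x : X r)
    (Y : ℝ → X r) : Prop :=
  ∀ p ∈ (opAStar a₀ a₁).graph, ∀ t ∈ Icc 0 T, ⟪Y t, p.1⟫_ℝ = ⟪x, p.1⟫_ℝ +
    (∫ s in (0 : ℝ)..t, (⟪Y s, p.2⟫_ℝ + ⟪opB b₀ b₁ (z s), p.1⟫_ℝ)) + ⟪opG r σ (w t), p.1⟫_ℝ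

lemma inner_mkX {r : ℝ} (y : X r) (p : ℝ) (u : L2 r) :
    ⟪y, mkX p u⟫_ℝ = p * y.fst + ⟪y.snd, u⟫_ℝ := by
  rw [WithLp.prod_inner_apply]
  simp

lemma inner_opB {r : ℝ} (b₀ : ℝ) (b₁ : L2 r) (z : ℝ) (p : X r) :
    ⟪opB b₀ b₁ z, p⟫_ℝ = z * ⟪mkX b₀ b₁, p⟫_ℝ := by
  rw [opB, ContinuousLinearMap.toSpanSingleton_apply, real_inner_smul_left]

lemma inner_opG {r : ℝ} (σ w : ℝ) (p : X r) : ⟪opG r σ w, p⟫_ℝ = σ * w * p.fst := by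
  rw [opG, ContinuousLinearMap.toSpanSingleton_apply, real_inner_smul_left,
    WithLp.prod_inner_apply]
  simp; ring

lemma continuous_fst_X {r : ℝ} {Y : ℝ → X r} (hY : Continuous Y) : Continuous fun s => (Y s).fst :=
  (WithLp.prod_continuous_ofLp 2 ℝ (L2 r)).fst.comp hY

lemma continuous_snd_X {r : ℝ} {Y : ℝ → X r} (hY : Continuous Y) : Continuous fun s => (Y s).snd :=
  (WithLp.prod_continuous_ofLp 2 ℝ (L2 r)).snd.comp hY

/-- The second primitive of the delay component of a weak solution, in terms of the initial datum,
of the first component and of the control. -/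
theorem hinge_snd_eq {r T a₀ b₀ σ : ℝ} (hr : 0 < r) (hT : 0 < T) {a₁ b₁ : L2 r} {z w : ℝ → ℝ}
    (hz : IntegrableOn z (Icc 0 T)) {x : X r} {Y : ℝ → X r} (hY : Continuous Y)
    (h : IsPathwiseWeakSolution a₀ b₀ σ a₁ b₁ T z w x Y) :
    ∀ t ∈ Icc 0 T, ∀ c ≤ 0, hinge (zeroExt r (Y t).snd) c = hinge (zeroExt r x.snd) (c - t) +
      ∫ u in (0 : ℝ)..t, ((Y u).fst * hinge (zeroExt r a₁) (c - t + u) +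
        z u * hinge (zeroExt r b₁) (c - t + u)) := by
  have hA := continuous_hinge (integrable_zeroExt a₁) (zeroExt_of_lt a₁)
  have hB := continuous_hinge (integrable_zeroExt b₁) (zeroExt_of_lt b₁)
  have hy := continuous_fst_X hY
  have hv := continuous_snd_X hY
  -- The test elements `(0, (c - ξ)⁺)`: the noise disappears.
  have hE : ∀ t ∈ Icc 0 T, ∀ c ≤ 0, hinge (zeroExt r (Y t).snd) c = hinge (zeroExt r x.snd) c +
      ∫ s in (0 : ℝ)..t, (((Y s).fst * hinge (zeroExt r a₁) c + z s * hinge (zeroExt r b₁) c) -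
        cumul (zeroExt r (Y s).snd) c) := fun t ht c hc => by
    have h1 := h _ (hinge_mem_graph_opAStar hr a₀ a₁ hc) t ht
    simp only [inner_opB, inner_opG] at h1
    simp only [inner_mkX, inner_neg_right, inner_hingeL2, WithLp.toLp_fst, WithLp.toLp_snd,
      inner_stepL2, zero_mul, mul_zero, zero_add, add_zero] at h1
    rw [h1]
    congr 1
    exact intervalIntegral.integral_congr fun s _ => by ring
  have hE0 : ∀ c ≤ 0, hinge (zeroExt r (Y 0).snd) c = hinge (zeroExt r x.snd) c := fun c hc => by
    have := hE 0 ⟨le_rfl, hT.le⟩ c hc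
    simpa using this
  -- A measurable representative of the control, cut off outside `[0, T]`.
  set k : ℝ → ℝ := (Icc 0 T).indicator (hz.aestronglyMeasurable.mk z) with hk
  have hkm : StronglyMeasurable k :=
    hz.aestronglyMeasurable.stronglyMeasurable_mk.indicator measurableSet_Icc
  have hkz : ∀ᵐ s, s ∈ Icc 0 T → k s = z s := by
    filter_upwards [(ae_restrict_iff' measurableSet_Icc).1 hz.aestronglyMeasurable.ae_eq_mk]
      with s hs hs'
    rw [hk, indicator_of_mem hs', hs hs']
  have hki : Integrable k :=
    IntegrableOn.integrable_indicator (Integrable.congr hz hz.aestronglyMeasurable.ae_eq_mk)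
      measurableSet_Icc
  set y : ℝ → ℝ := (Icc 0 T).indicator fun s => (Y s).fst with hydef
  have hym : StronglyMeasurable y := hy.stronglyMeasurable.indicator measurableSet_Icc
  have hyi : Integrable y :=
    (hy.continuousOn.integrableOn_compact isCompact_Icc).integrable_indicator measurableSet_Icc
  have hcong : ∀ t ∈ Icc 0 T, ∀ f g : ℝ → ℝ, ∫ s in (0 : ℝ)..t, (y s * f s + k s * g s) =
      ∫ s in (0 : ℝ)..t, ((Y s).fst * f s + z s * g s) := fun t ht f g => by
    refine intervalIntegral.integral_congr_ae ?_
    filter_upwards [hkz] with s hs hs'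
    rw [uIoc_of_le ht.1] at hs'
    have : s ∈ Icc 0 T := ⟨hs'.1.le, hs'.2.trans ht.2⟩
    rw [hs this, hydef, indicator_of_mem this]
  set KA : ℝ := r * ∫ ξ, |zeroExt r a₁ ξ| with hKA
  set KB : ℝ := r * ∫ ξ, |zeroExt r b₁ ξ| with hKB
  obtain ⟨K, hK⟩ := (isCompact_Icc (a := (0 : ℝ)) (b := T)).exists_bound_of_continuousOn
    (f := fun s => (Y s).snd) hv.continuousOn
  obtain ⟨K', hK'⟩ : ∃ K', ∀ c, ‖stepL2 r c‖ ≤ K' := by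
    refine ⟨_, fun c => Lp.norm_le_of_ae_bound (C := 1) zero_le_one ?_⟩
    filter_upwards [(memLp_indicator_Iic r c).coeFn_toLp] with ξ hξ
    rw [stepL2, hξ]
    by_cases h : ξ ≤ c <;> simp [h]
  have hΦc : ∀ c, Continuous fun s => cumul (zeroExt r (Y s).snd) c := fun c => by
    simp_rw [← inner_stepL2]
    exact hv.inner continuous_const
  have main := eq_along_characteristic (T := T) (K := K * K')
    (Φ := fun s c => cumul (zeroExt r (Y s).snd) c)
    (Ψ := fun s c => hinge (zeroExt r (Y s).snd) c)
    (g := fun s c => y s * hinge (zeroExt r a₁) c + k s * hinge (zeroExt r b₁) c)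
    (G := fun s => |y s| * KA + |k s| * KB) hT ?_ ?_ ?_ ?_ ?_ ?_ ?_ ?_ ?_ ?_
  · intro t ht c hc
    rw [main t ht c hc, hE0 _ (by linarith [ht.1])]
    congr 1
    exact hcong t ht _ _
  · have := stronglyMeasurable_uncurry_of_continuous_of_stronglyMeasurable
      (u := fun c s => cumul (zeroExt r (Y s).snd) c)
      (fun s => continuous_cumul (integrable_zeroExt _)) (fun c => (hΦc c).stronglyMeasurable)
    exact this.comp_measurable measurable_swap
  · intro s hs c
    rw [← inner_stepL2]
    refine (abs_real_inner_le_norm _ _).trans ?_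
    exact mul_le_mul (hK s hs) (hK' c) (norm_nonneg _) ((norm_nonneg _).trans (hK s hs))
  · exact ((hym.comp_measurable measurable_fst).mul
      (hA.stronglyMeasurable.comp_measurable measurable_snd)).add
      ((hkm.comp_measurable measurable_fst).mul
      (hB.stronglyMeasurable.comp_measurable measurable_snd))
  · intro s; fun_prop
  · exact (hyi.abs.mul_const _).add (hki.abs.mul_const _)
  · intro s c hc
    refine (abs_add_le _ _).trans ?_
    rw [abs_mul, abs_mul]
    gcongr
    · exact abs_hinge_le hr (integrable_zeroExt a₁) (zeroExt_of_lt a₁) hc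
    · exact abs_hinge_le hr (integrable_zeroExt b₁) (zeroExt_of_lt b₁) hc
  · intro c
    simp_rw [← inner_hingeL2]
    exact hv.inner continuous_const
  · exact continuous_hinge (integrable_zeroExt _) (zeroExt_of_lt _)
  · exact fun s c c' => hinge_sub_hinge (integrable_zeroExt _) (zeroExt_of_lt _) c c'
  · intro t ht c hc
    rw [hE t ht c hc, hE0 c hc, hcong t ht (fun _ => hinge (zeroExt r a₁) c)
      (fun _ => hinge (zeroExt r b₁) c), intervalIntegral.integral_sub]
    · ring
    · refine (hy.mul continuous_const).intervalIntegrable _ _ |>.add ?_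
      refine IntervalIntegrable.mul_const ?_ _
      rw [intervalIntegrable_iff_integrableOn_Ioc_of_le ht.1]
      exact hz.mono_set (Ioc_subset_Icc_self.trans (Icc_subset_Icc_right ht.2))
    · exact (hΦc c).intervalIntegrable _ _

/-- The equation of the first component plus the mean of the delay component, obtained from the
constant test element. -/
lemma fst_add_integral_snd_eq {r T a₀ b₀ σ : ℝ} (hr : 0 < r) {a₁ b₁ : L2 r}
    {z w : ℝ → ℝ} {x : X r} {Y : ℝ → X r}
    (h : IsPathwiseWeakSolution a₀ b₀ σ a₁ b₁ T z w x Y) {t : ℝ} (ht : t ∈ Icc 0 T) :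
    (Y t).fst + cumul (zeroExt r (Y t).snd) 0 = x.fst + cumul (zeroExt r x.snd) 0 +
      (∫ s in (0 : ℝ)..t, ((a₀ + ∫ ξ, zeroExt r a₁ ξ) * (Y s).fst +
        z s * (b₀ + cumul (zeroExt r b₁) 0))) + σ * w t := by
  have h1 := h _ (const_mem_graph_opAStar hr a₀ a₁) t ht
  simp only [inner_opB, inner_opG] at h1
  simpa only [inner_mkX, inner_zero_right, inner_stepL2, mul_one, WithLp.toLp_fst,
    WithLp.toLp_snd, one_mul, add_zero] using h1

/-! ### The delay component as a past convolution -/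

lemma integrable_hinge_mul {a h : ℝ → ℝ} {r s c : ℝ} (hr : 0 < r) (ha : Integrable a)
    (h0 : ∀ ξ < -r, a ξ = 0) (hh : Integrable h) (hc : c + s ≤ 0) :
    IntegrableOn (fun u => hinge a (c + u) * h u) (Iic s) := by
  refine Integrable.bdd_mul (c := r * ∫ ξ, |a ξ|) hh.integrableOn
    ((continuous_hinge ha h0).comp (by fun_prop)).aestronglyMeasurable ?_
  filter_upwards [ae_restrict_mem measurableSet_Iic] with u hu
  exact abs_hinge_le hr ha h0 (by linarith [mem_Iic.1 hu])

/-- If `h` and `k` extend the first component and the control to the past in a way that is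
compatible with the initial datum, then the delay component is given by past convolutions. -/
theorem snd_ae_eq_pastConv {r T a₀ b₀ σ : ℝ} (hr : 0 < r) (hT : 0 < T) {a₁ b₁ : L2 r}
    {z w : ℝ → ℝ} (hz : IntegrableOn z (Icc 0 T)) {x : X r} {Y : ℝ → X r} (hY : Continuous Y)
    (hsol : IsPathwiseWeakSolution a₀ b₀ σ a₁ b₁ T z w x Y) {h k : ℝ → ℝ} (hh : Integrable h)
    (hk : Integrable k) (hhY : ∀ s ∈ Icc 0 T, h s = (Y s).fst) (hkz : ∀ s ∈ Icc 0 T, k s = z s)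
    {t : ℝ} (ht : t ∈ Icc 0 T)
    (hx : ∀ c ≤ 0, hinge (zeroExt r x.snd) (c - t) =
      (∫ u in Iic 0, hinge (zeroExt r a₁) (c - t + u) * h u) +
      ∫ u in Iic 0, hinge (zeroExt r b₁) (c - t + u) * k u) :
    (Y t).snd =ᵐ[delayMeasure r]
      fun ξ => pastConv (zeroExt r a₁) h t ξ + pastConv (zeroExt r b₁) k t ξ := by
  have ia := integrable_zeroExt a₁
  have ib := integrable_zeroExt b₁
  have za := zeroExt_of_lt (r := r) a₁
  have zb := zeroExt_of_lt (r := r) b₁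
  have ipa := integrable_pastConv ia hh t
  have ipb := integrable_pastConv ib hk t
  have zpa : ∀ ξ < -r, pastConv (zeroExt r a₁) h t ξ = 0 := fun ξ hξ => pastConv_eq_zero za t hξ
  have zpb : ∀ ξ < -r, pastConv (zeroExt r b₁) k t ξ = 0 := fun ξ hξ => pastConv_eq_zero zb t hξ
  have key : ∀ c ∈ Icc (-r) 0, hinge (fun ξ => zeroExt r (Y t).snd ξ -
      (pastConv (zeroExt r a₁) h t ξ + pastConv (zeroExt r b₁) k t ξ)) c = 0 := fun c hc => by
    rw [hinge_sub (w := fun ξ => pastConv (zeroExt r a₁) h t ξ + pastConv (zeroExt r b₁) k t ξ)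
      (integrable_zeroExt _) (zeroExt_of_lt _) (ipa.add ipb)
      (fun ξ hξ => by rw [zpa ξ hξ, zpb ξ hξ, add_zero]), hinge_add ipa zpa ipb zpb,
      hinge_pastConv ia za hh, hinge_pastConv ib zb hk,
      hinge_snd_eq hr hT hz hY hsol t ht c hc.2, hx c hc.2]
    have split : ∀ {a g : ℝ → ℝ}, Integrable a → (∀ ξ < -r, a ξ = 0) → Integrable g →
        ∫ u in Iic t, hinge a (c - t + u) * g u =
          (∫ u in Iic 0, hinge a (c - t + u) * g u) +
            ∫ u in (0 : ℝ)..t, hinge a (c - t + u) * g u := fun {a g} ha h0 hg => by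
      rw [← intervalIntegral.integral_Iic_sub_Iic
        (integrable_hinge_mul hr ha h0 hg (by linarith [hc.2, ht.1]))
        (integrable_hinge_mul hr ha h0 hg (by linarith [hc.2]))]
      ring
    have ii : ∀ {a g : ℝ → ℝ}, Integrable a → (∀ ξ < -r, a ξ = 0) → Integrable g →
        IntervalIntegrable (fun u => hinge a (c - t + u) * g u) volume 0 t :=
      fun {a g} ha h0 hg => by
        rw [intervalIntegrable_iff_integrableOn_Ioc_of_le ht.1]
        exact (integrable_hinge_mul hr ha h0 hg (by linarith [hc.2])).mono_set Ioc_subset_Iic_self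
    have e : ∫ u in (0 : ℝ)..t, ((Y u).fst * hinge (zeroExt r a₁) (c - t + u) +
        z u * hinge (zeroExt r b₁) (c - t + u)) =
        ∫ u in (0 : ℝ)..t, (hinge (zeroExt r a₁) (c - t + u) * h u +
          hinge (zeroExt r b₁) (c - t + u) * k u) := by
      refine intervalIntegral.integral_congr fun u hu => ?_
      rw [uIcc_of_le ht.1] at hu
      have hu' : u ∈ Icc 0 T := ⟨hu.1, hu.2.trans ht.2⟩
      rw [hhY u hu', hkz u hu']
      ring
    rw [split ia za hh, split ib zb hk, e,
      intervalIntegral.integral_add (ii ia za hh) (ii ib zb hk)]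
    ring
  have hz := ae_eq_zero_of_hinge_eq_zero ((integrable_zeroExt _).sub (ipa.add ipb))
    (fun ξ hξ => by simp [zpa ξ hξ, zpb ξ hξ, zeroExt_of_lt _ ξ hξ]) key
  refine (ae_restrict_iff' measurableSet_Icc).2 ?_
  filter_upwards [hz] with ξ hξ hmem
  have := hξ hmem
  simp only [Pi.sub_apply, Pi.add_apply, zeroExt_of_mem _ hmem] at this
  linarith

/-- The convolution `delayConv` with the segment `h(t + ·)` is a past convolution. -/
lemma delayConv_eq_pastConv {r t : ℝ} (a : L2 r) {u : L2 r} {h : ℝ → ℝ}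
    (hu : u =ᵐ[delayMeasure r] fun ξ => h (t + ξ)) {ξ : ℝ} (hξ : ξ ∈ Icc (-r) 0) :
    delayConv a u ξ = pastConv (zeroExt r a) h t ξ := by
  have e : ∀ ζ, zeroExt r a ζ * h (t + ζ - ξ) =
      (Icc (-r) 0).indicator (fun ζ => a ζ * h (t + ζ - ξ)) ζ := fun ζ => by
    by_cases hζ : ζ ∈ Icc (-r) 0 <;> simp [zeroExt, hζ]
  rw [delayConv, pastConv, intervalIntegral.integral_of_le hξ.1]
  simp_rw [e]
  rw [setIntegral_indicator measurableSet_Icc]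
  have e2 : Iic ξ ∩ Icc (-r) 0 = Icc (-r) ξ := by
    ext ζ; constructor
    · exact fun hζ => ⟨hζ.2.1, hζ.1⟩
    · exact fun hζ => ⟨hζ.2, hζ.1, hζ.2.trans hξ.2⟩
  rw [e2, integral_Icc_eq_integral_Ioc]
  refine setIntegral_congr_ae measurableSet_Ioc ?_
  have h1 : ∀ᵐ η, η ∈ Icc (-r) 0 → u η = h (t + η) := (ae_restrict_iff' measurableSet_Icc).1 hu
  filter_upwards [(measurePreserving_sub_right volume ξ).quasiMeasurePreserving.ae h1] with ζ h2 hζ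
  rw [h2 ⟨by linarith [hζ.1, hξ.2], by linarith [hζ.2]⟩, add_sub_assoc]

lemma opM_snd_ae_eq {r t : ℝ} (a b : L2 r) {x : X r} {v : L2 r} {h k : ℝ → ℝ}
    (hx : x.snd =ᵐ[delayMeasure r] fun ξ => h (t + ξ))
    (hv : v =ᵐ[delayMeasure r] fun ξ => k (t + ξ)) :
    (opM a b x v).snd =ᵐ[delayMeasure r]
      fun ξ => pastConv (zeroExt r a) h t ξ + pastConv (zeroExt r b) k t ξ := by
  filter_upwards [((memLp_delayConv a x.snd).add (memLp_delayConv b v)).coeFn_toLp,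
    ae_restrict_mem measurableSet_Icc] with ξ h1 hξ
  rw [← delayConv_eq_pastConv a hx hξ, ← delayConv_eq_pastConv b hv hξ]
  exact h1

lemma eq_opM {r t : ℝ} (a b : L2 r) {y : X r} {u v : L2 r} {h k : ℝ → ℝ}
    (hu : u =ᵐ[delayMeasure r] fun ξ => h (t + ξ))
    (hv : v =ᵐ[delayMeasure r] fun ξ => k (t + ξ))
    (hy : y.snd =ᵐ[delayMeasure r]
      fun ξ => pastConv (zeroExt r a) h t ξ + pastConv (zeroExt r b) k t ξ) :
    y = opM a b (mkX y.fst u) v := by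
  have h1 : y.snd = (opM a b (mkX y.fst u) v).snd :=
    Lp.ext (hy.trans (opM_snd_ae_eq a b (x := mkX y.fst u) hu hv).symm)
  have h2 : y = mkX y.fst y.snd := rfl
  rw [h2, h1]
  rfl

/-! ### Delay integrals and uniqueness for the delay equation -/

/-- The delay integral `∫ a(ζ) h(s + ζ) dζ`. -/
def delayInt (a h : ℝ → ℝ) (s : ℝ) : ℝ := ∫ ζ, a ζ * h (s + ζ)

lemma integrable_delayInt_integrand {a h : ℝ → ℝ} (ha : Integrable a) (hh : Integrable h) :
    Integrable (fun p : ℝ × ℝ => a p.2 * h (-p.1 + p.2)) (volume.prod volume) := by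
  refine (ha.convolution_integrand (ContinuousLinearMap.mul ℝ ℝ) hh.comp_neg).congr
    (Filter.Eventually.of_forall fun p => ?_)
  simp [neg_add_eq_sub]

lemma integrable_delayInt {a h : ℝ → ℝ} (ha : Integrable a) (hh : Integrable h) :
    Integrable (delayInt a h) := by
  have := (integrable_delayInt_integrand ha hh).integral_prod_left.comp_neg
  simp only [neg_neg] at this
  exact this

lemma integral_delayInt {a h : ℝ → ℝ} (ha : Integrable a) (hh : Integrable h) (t : ℝ) :
    ∫ s in (0 : ℝ)..t, delayInt a h s = ∫ ζ, a ζ * (cumul h (t + ζ) - cumul h ζ) := by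
  have h1 : ∫ s in (0 : ℝ)..t, delayInt a h s =
      ∫ x in (-t)..0, ∫ ζ, a ζ * h (-x + ζ) := by
    have := intervalIntegral.integral_comp_neg (a := 0) (b := t) fun x => delayInt a h (-x)
    simpa [delayInt] using this
  rw [h1, intervalIntegral_integral_swap]
  · refine integral_congr_ae (Filter.Eventually.of_forall fun ζ => ?_)
    simp only
    rw [intervalIntegral.integral_const_mul, cumul_sub_cumul hh]
    have := intervalIntegral.integral_comp_sub_left (a := -t) (b := 0) h ζ
    simp only [sub_zero, sub_neg_eq_add] at this
    rw [add_comm t, ← this]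
    simp_rw [neg_add_eq_sub]
  · have := (integrable_delayInt_integrand ha hh).integrableOn (s := uIoc (-t) 0 ×ˢ univ)
    rwa [IntegrableOn, ← Measure.prod_restrict, Measure.restrict_univ] at this

lemma abs_cumul_le {v : ℝ → ℝ} (hv : Integrable v) (c : ℝ) : |cumul v c| ≤ ∫ ξ, |v ξ| := by
  refine (norm_integral_le_integral_norm (f := v) (μ := volume.restrict (Iic c))).trans ?_
  exact setIntegral_le_integral hv.norm (Filter.Eventually.of_forall fun _ => norm_nonneg _)

lemma integrable_mul_cumul {a h : ℝ → ℝ} (ha : Integrable a) (hh : Integrable h) (t : ℝ) :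
    Integrable fun ζ => a ζ * cumul h (t + ζ) :=
  ha.mul_bdd ((continuous_cumul hh).comp (by fun_prop)).aestronglyMeasurable
    (Filter.Eventually.of_forall fun _ => abs_cumul_le hh _)

lemma setIntegral_pastConv {r : ℝ} {a : ℝ → ℝ} {h : ℝ → ℝ} (ha : Integrable (zeroExt r a))
    (hh : Integrable h) (t : ℝ) :
    ∫ ξ in Icc (-r) 0, pastConv (zeroExt r a) h t ξ =
      ∫ ζ, zeroExt r a ζ * (cumul h t - cumul h (t + ζ)) := by
  set p : ℝ → ℝ := (Icc (-r) 0).indicator fun _ => 1 with hp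
  have e : ∫ ξ in Icc (-r) 0, pastConv (zeroExt r a) h t ξ =
      ∫ ξ, p ξ * pastConv (zeroExt r a) h t ξ := by
    rw [← integral_indicator measurableSet_Icc]
    refine integral_congr_ae (Filter.Eventually.of_forall fun ξ => ?_)
    by_cases hξ : ξ ∈ Icc (-r) 0 <;> simp [hp, hξ]
  rw [e, integral_mul_pastConv (K := 1) ha hh (measurable_const.indicator measurableSet_Icc)
    (fun ξ => by by_cases hξ : ξ ∈ Icc (-r) 0 <;> simp [hξ])]
  refine integral_congr_ae (Filter.Eventually.of_forall fun ζ => ?_)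
  simp only
  by_cases hζ : ζ ∈ Icc (-r) 0
  · congr 1
    rw [cumul_sub_cumul hh, intervalIntegral.integral_of_le (by linarith [hζ.2]),
      ← integral_Icc_eq_integral_Ioc]
    have e2 : ∀ u ∈ Iic t, p (t + ζ - u) * h u = (Ici (t + ζ)).indicator h u := fun u hu => by
      by_cases hu' : t + ζ ≤ u
      · have : t + ζ - u ∈ Icc (-r) 0 := ⟨by linarith [hζ.1, mem_Iic.1 hu], by linarith⟩
        rw [hp, indicator_of_mem this, indicator_of_mem (mem_Ici.2 hu'), one_mul]
      · have : t + ζ - u ∉ Icc (-r) 0 := fun h1 => hu' (by linarith [h1.2])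
        rw [hp, indicator_of_notMem this, indicator_of_notMem (by simpa using hu'), zero_mul]
    rw [setIntegral_congr_fun measurableSet_Iic e2, setIntegral_indicator measurableSet_Ici,
      inter_comm, Ici_inter_Iic]
  · simp [zeroExt, hζ]

/-- The integral of a past convolution over the delay interval absorbs the delay integral: this
turns the equation of the constant test element into the delay equation. -/
lemma setIntegral_pastConv_add_integral_delayInt {r : ℝ} {a h : ℝ → ℝ}
    (ha : Integrable (zeroExt r a)) (hh : Integrable h) (t : ℝ) :
    (∫ ξ in Icc (-r) 0, pastConv (zeroExt r a) h t ξ) +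
      (∫ s in (0 : ℝ)..t, delayInt (zeroExt r a) h s) =
    (∫ ξ in Icc (-r) 0, pastConv (zeroExt r a) h 0 ξ) +
      (∫ ξ, zeroExt r a ξ) * ∫ s in (0 : ℝ)..t, h s := by
  have i1 := integrable_mul_cumul ha hh t
  have i2 := integrable_mul_cumul ha hh 0
  simp only [zero_add] at i2
  have e1 : Integrable fun ζ => zeroExt r a ζ * (cumul h t - cumul h (t + ζ)) := by
    simp_rw [mul_sub]; exact (ha.mul_const _).sub i1
  have e2 : Integrable fun ζ => zeroExt r a ζ * (cumul h (t + ζ) - cumul h ζ) := by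
    simp_rw [mul_sub]; exact i1.sub i2
  have e3 : Integrable fun ζ => zeroExt r a ζ * (cumul h 0 - cumul h (0 + ζ)) := by
    simp_rw [mul_sub, zero_add]; exact (ha.mul_const _).sub i2
  rw [setIntegral_pastConv ha hh, setIntegral_pastConv ha hh, integral_delayInt ha hh,
    ← integral_mul_const, ← integral_add e1 e2, ← integral_add e3 (ha.mul_const _),
    ← cumul_sub_cumul hh]
  refine integral_congr_ae (Filter.Eventually.of_forall fun ζ => ?_)
  simp only [zero_add]
  ring

/-- Uniqueness for the linear delay equation, by Gronwall's inequality for `∫_0^t |d|`. -/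
lemma eq_zero_of_delay_equation {r T a₀ : ℝ} {a d e : ℝ → ℝ}
    (ha : Integrable (zeroExt r a)) (hd : ContinuousOn d (Icc 0 T)) (he : Integrable e)
    (hed : ∀ s ∈ Icc 0 T, e s = d s) (he0 : ∀ s < 0, e s = 0)
    (heq : ∀ t ∈ Icc 0 T, d t = a₀ * (∫ s in (0 : ℝ)..t, d s) +
      ∫ ζ, zeroExt r a ζ * (cumul e (t + ζ) - cumul e ζ)) :
    ∀ t ∈ Icc 0 T, d t = 0 := by
  set v : ℝ → ℝ := fun t => ∫ s in (0 : ℝ)..t, |d s| with hv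
  have hdi : ∀ t ∈ Icc 0 T, ∀ s ∈ Icc 0 t, IntervalIntegrable (fun s => |d s|) volume s t :=
    fun t ht s hs => by
      refine ContinuousOn.intervalIntegrable ?_
      rw [uIcc_of_le hs.2]
      exact (hd.mono (Icc_subset_Icc hs.1 ht.2)).abs
  have hv0 : ∀ t ∈ Icc 0 T, 0 ≤ v t := fun t ht =>
    intervalIntegral.integral_nonneg ht.1 fun _ _ => abs_nonneg _
  have hmono : ∀ t ∈ Icc 0 T, ∀ s ∈ Icc 0 t, v s ≤ v t := fun t ht s hs => by
    rw [hv]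
    simp only
    rw [← intervalIntegral.integral_add_adjacent_intervals
      (hdi s ⟨hs.1, hs.2.trans ht.2⟩ 0 ⟨le_rfl, hs.1⟩) (hdi t ht s hs)]
    linarith [intervalIntegral.integral_nonneg (f := fun s => |d s|) (μ := volume) hs.2
      fun _ _ => abs_nonneg _]
  have hcneg : ∀ s ≤ 0, cumul e s = 0 := fun s hs =>
    cumul_eq_zero (r := 0) (fun ξ hξ => he0 ξ (by simpa using hξ)) (by simpa using hs)
  have hcum : ∀ t ∈ Icc 0 T, cumul e t = ∫ s in (0 : ℝ)..t, d s := fun t ht => by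
    have := cumul_sub_cumul he 0 t
    rw [hcneg 0 le_rfl, sub_zero] at this
    rw [this]
    refine intervalIntegral.integral_congr fun s hs => ?_
    rw [uIcc_of_le ht.1] at hs
    exact hed s ⟨hs.1, hs.2.trans ht.2⟩
  have hcv : ∀ t ∈ Icc 0 T, ∀ s ≤ t, |cumul e s| ≤ v t := fun t ht s hs => by
    rcases le_total s 0 with h | h
    · rw [hcneg s h, abs_zero]; exact hv0 t ht
    · rw [hcum s ⟨h, hs.trans ht.2⟩]
      exact (intervalIntegral.abs_integral_le_integral_abs h).trans (hmono t ht s ⟨h, hs⟩)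
  set K : ℝ := |a₀| + ∫ ζ, |zeroExt r a ζ| with hK
  have hdv : ∀ t ∈ Icc 0 T, |d t| ≤ K * v t := fun t ht => by
    rw [heq t ht, hK, add_mul]
    refine (abs_add_le _ _).trans (add_le_add ?_ ?_)
    · rw [abs_mul, ← hcum t ht]
      exact mul_le_mul_of_nonneg_left (hcv t ht t le_rfl) (abs_nonneg _)
    · rw [← integral_mul_const]
      refine norm_integral_le_of_norm_le
        (f := fun ζ => zeroExt r a ζ * (cumul e (t + ζ) - cumul e ζ)) (ha.abs.mul_const _)
        (Filter.Eventually.of_forall fun ζ => ?_)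
      rw [norm_mul]
      by_cases hζ : ζ ∈ Icc (-r) 0
      · refine mul_le_mul_of_nonneg_left ?_ (abs_nonneg _)
        rw [hcneg ζ hζ.2, sub_zero]
        exact hcv t ht _ (by linarith [hζ.2])
      · simp [zeroExt, hζ]
  have hderiv : ∀ t ∈ Ico 0 T, HasDerivWithinAt v |d t| (Ici t) t := fun t ht => by
    have hc : ContinuousWithinAt (fun s => |d s|) (Icc t T) t :=
      (hd.abs t ⟨ht.1, ht.2.le⟩).mono (Icc_subset_Icc_left ht.1)
    have : HasDerivWithinAt v |d t| (Icc t T) t := by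
      have : Fact (t ∈ Icc t T) := ⟨le_rfl, ht.2.le⟩
      refine intervalIntegral.integral_hasDerivWithinAt_right
        (hdi t ⟨ht.1, ht.2.le⟩ 0 ⟨le_rfl, ht.1⟩) ?_ hc
      exact (hd.abs.mono (Icc_subset_Icc_left ht.1)).stronglyMeasurableAtFilter_nhdsWithin
        measurableSet_Icc t
    exact this.mono_of_mem_nhdsWithin (Icc_mem_nhdsGE ht.2)
  have hvc : ContinuousOn v (Icc 0 T) := by
    rcases le_or_gt 0 T with hT | hT
    · have := intervalIntegral.continuousOn_primitive_interval (f := fun s => |d s|) (a := 0)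
        (b := T) (μ := volume) (by
          rw [uIcc_of_le hT]; exact hd.abs.integrableOn_compact isCompact_Icc)
      rwa [uIcc_of_le hT] at this
    · rw [Icc_eq_empty (not_le.2 hT)]; exact continuousOn_empty _
  intro t ht
  have hvt : v t = 0 := by
    have := norm_le_gronwallBound_of_norm_deriv_right_le (f := v) (f' := fun t => |d t|)
      (δ := 0) (K := K) (ε := 0) hvc hderiv (by simp [hv]) (fun s hs => by
        have hs' : s ∈ Icc 0 T := ⟨hs.1, hs.2.le⟩
        rw [add_zero, Real.norm_eq_abs, abs_abs, Real.norm_of_nonneg (hv0 s hs')]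
        exact hdv s hs') t ht
    rw [gronwallBound_ε0_δ0] at this
    exact norm_le_zero_iff.1 this
  have := hdv t ht
  rw [hvt, mul_zero] at this
  exact abs_nonpos_iff.1 this

/-- The first component of a weak solution solves the delay equation, as soon as the delay
component is given by past convolutions. -/
theorem fst_eq_delay_equation {r T a₀ b₀ σ : ℝ} (hr : 0 < r) {a₁ b₁ : L2 r} {z w : ℝ → ℝ}
    (hz : IntegrableOn z (Icc 0 T)) {x : X r} {Y : ℝ → X r} (hY : Continuous Y)
    (hsol : IsPathwiseWeakSolution a₀ b₀ σ a₁ b₁ T z w x Y) {h k : ℝ → ℝ} (hh : Integrable h)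
    (hk : Integrable k) (hhY : ∀ s ∈ Icc 0 T, h s = (Y s).fst) (hkz : ∀ s ∈ Icc 0 T, k s = z s)
    {t : ℝ} (ht : t ∈ Icc 0 T)
    (hx : x.snd =ᵐ[delayMeasure r]
      fun ξ => pastConv (zeroExt r a₁) h 0 ξ + pastConv (zeroExt r b₁) k 0 ξ)
    (hYt : (Y t).snd =ᵐ[delayMeasure r]
      fun ξ => pastConv (zeroExt r a₁) h t ξ + pastConv (zeroExt r b₁) k t ξ) :
    (Y t).fst = x.fst + (a₀ * (∫ s in (0 : ℝ)..t, (Y s).fst) +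
      (∫ s in (0 : ℝ)..t, delayInt (zeroExt r a₁) h s) + b₀ * (∫ s in (0 : ℝ)..t, z s) +
      ∫ s in (0 : ℝ)..t, delayInt (zeroExt r b₁) k s) + σ * w t := by
  have ia := integrable_zeroExt a₁
  have ib := integrable_zeroExt b₁
  have hcum : ∀ u : L2 r, cumul (zeroExt r u) 0 = ∫ ξ in Icc (-r) 0, u ξ := fun u => by
    rw [cumul, zeroExt, setIntegral_indicator measurableSet_Icc, inter_eq_right.2]
    exact fun ξ hξ => hξ.2
  have hcum' : cumul (zeroExt r b₁) 0 = ∫ ξ, zeroExt r b₁ ξ := by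
    rw [hcum, zeroExt, integral_indicator measurableSet_Icc]
  have hmean : ∀ {u : L2 r} {t : ℝ}, u =ᵐ[delayMeasure r]
      (fun ξ => pastConv (zeroExt r a₁) h t ξ + pastConv (zeroExt r b₁) k t ξ) →
      cumul (zeroExt r u) 0 = (∫ ξ in Icc (-r) 0, pastConv (zeroExt r a₁) h t ξ) +
        ∫ ξ in Icc (-r) 0, pastConv (zeroExt r b₁) k t ξ := fun {u t} hu => by
    rw [hcum, integral_congr_ae hu, integral_add (integrable_pastConv ia hh t).integrableOn
      (integrable_pastConv ib hk t).integrableOn]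
  have h1 := fst_add_integral_snd_eq hr hsol ht
  have iY : IntervalIntegrable (fun s => (Y s).fst) volume 0 t :=
    (continuous_fst_X hY).intervalIntegrable _ _
  have iz : IntervalIntegrable z volume 0 t := by
    rw [intervalIntegrable_iff_integrableOn_Ioc_of_le ht.1]
    exact hz.mono_set (Ioc_subset_Icc_self.trans (Icc_subset_Icc_right ht.2))
  have eh : ∫ s in (0 : ℝ)..t, h s = ∫ s in (0 : ℝ)..t, (Y s).fst :=
    intervalIntegral.integral_congr fun s hs => by
      rw [uIcc_of_le ht.1] at hs; exact hhY s ⟨hs.1, hs.2.trans ht.2⟩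
  have ek : ∫ s in (0 : ℝ)..t, k s = ∫ s in (0 : ℝ)..t, z s :=
    intervalIntegral.integral_congr fun s hs => by
      rw [uIcc_of_le ht.1] at hs; exact hkz s ⟨hs.1, hs.2.trans ht.2⟩
  rw [hmean hYt, hmean hx, intervalIntegral.integral_add (iY.const_mul _) (iz.mul_const _),
    intervalIntegral.integral_const_mul, intervalIntegral.integral_mul_const, hcum'] at h1
  have h2 := setIntegral_pastConv_add_integral_delayInt ia hh t
  have h3 := setIntegral_pastConv_add_integral_delayInt ib hk t
  rw [eh] at h2
  rw [ek] at h3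
  linarith

lemma integral_mul_segment_eq_delayInt {r T s : ℝ} (hr : 0 < r) (a F : ℝ → ℝ) (hs : s ∈ Icc 0 T) :
    ∫ ξ in (-r)..0, a ξ * F (s + ξ) = delayInt (zeroExt r a) ((Icc (-r) T).indicator F) s := by
  rw [intervalIntegral.integral_of_le (by linarith), ← integral_Icc_eq_integral_Ioc,
    ← integral_indicator measurableSet_Icc, delayInt]
  refine integral_congr_ae (Filter.Eventually.of_forall fun ξ => ?_)
  by_cases hξ : ξ ∈ Icc (-r) 0
  · have : s + ξ ∈ Icc (-r) T := ⟨by linarith [hs.1, hξ.1], by linarith [hs.2, hξ.2]⟩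
    simp only
    rw [indicator_of_mem hξ, zeroExt, indicator_of_mem hξ, indicator_of_mem this]
  · simp [zeroExt, hξ]

/-! ### Segments of paths -/

/-- The function equal to `η` before time `0` and to `f` from time `0` on. -/
def glue (η f : ℝ → ℝ) (s : ℝ) : ℝ := if s < 0 then η s else f s

lemma memLp_glue {r T : ℝ} {η f : ℝ → ℝ} (hη : MemLp η 2 (delayMeasure r))
    (hf : MemLp f 2 (volume.restrict (Icc 0 T))) :
    MemLp (glue η f) 2 (volume.restrict (Icc (-r) T)) := by
  have h1 : MemLp ((Ico (-r) 0).indicator η) 2 volume :=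
    (memLp_indicator_iff_restrict measurableSet_Ico).2
      (hη.mono_measure (Measure.restrict_mono Ico_subset_Icc_self le_rfl))
  have h2 : MemLp ((Icc 0 T).indicator f) 2 volume :=
    (memLp_indicator_iff_restrict measurableSet_Icc).2 hf
  refine ((h1.add h2).restrict (Icc (-r) T)).ae_eq ?_
  filter_upwards [ae_restrict_mem measurableSet_Icc] with s hs
  rw [Pi.add_apply, glue]
  by_cases h : s < 0
  · rw [if_pos h, indicator_of_mem (show s ∈ Ico (-r) 0 from ⟨hs.1, h⟩),
      indicator_of_notMem (fun h' => absurd h'.1 (not_le.2 h)), add_zero]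
  · rw [if_neg h, indicator_of_notMem (fun h' => h h'.2),
      indicator_of_mem (show s ∈ Icc 0 T from ⟨not_lt.1 h, hs.2⟩), zero_add]

lemma memLp_segment {F : ℝ → ℝ} {r l t T : ℝ} (hF : MemLp F 2 (volume.restrict (Icc l T)))
    (hl : l ≤ t - r) (ht : t ≤ T) : MemLp (fun ξ => F (t + ξ)) 2 (delayMeasure r) := by
  have hF' : MemLp F 2 (volume.restrict (Icc (t - r) t)) :=
    hF.mono_measure (Measure.restrict_mono (Icc_subset_Icc hl ht) le_rfl)
  have := (measurePreserving_add_left volume t).restrict_preimage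
    (measurableSet_Icc (a := t - r) (b := t))
  have e : (fun x => t + x) ⁻¹' Icc (t - r) t = Icc (-r) 0 := by
    rw [preimage_const_add_Icc]; congr 1 <;> ring
  rw [e] at this
  exact hF'.comp_measurePreserving this

lemma integrable_indicator_of_memLp {F : ℝ → ℝ} {l T : ℝ}
    (hF : MemLp F 2 (volume.restrict (Icc l T))) : Integrable ((Icc l T).indicator F) :=
  IntegrableOn.integrable_indicator (hF.integrable (by norm_num)) measurableSet_Icc

lemma memLp_of_continuousOn {f : ℝ → ℝ} {T : ℝ} (hf : ContinuousOn f (Icc 0 T)) :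
    MemLp f 2 (volume.restrict (Icc 0 T)) := by
  obtain ⟨K, hK⟩ := isCompact_Icc.exists_bound_of_continuousOn hf
  exact MemLp.of_bound (hf.aestronglyMeasurable measurableSet_Icc) K
    ((ae_restrict_mem measurableSet_Icc).mono hK)

/-! ### Path by path identification -/

/-- From the delay time `r` on, the state of a weak solution is the image under `M` of the segments
of its first component and of the control, whatever the initial datum. -/
theorem pathwise_eq_opM_of_le {r T a₀ b₀ σ : ℝ} (hr : 0 < r) (hT : 0 < T) {a₁ b₁ : L2 r}
    {z w : ℝ → ℝ} (hz : MemLp z 2 (volume.restrict (Icc 0 T))) {x : X r} {Y : ℝ → X r}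
    (hY : Continuous Y) (hsol : IsPathwiseWeakSolution a₀ b₀ σ a₁ b₁ T z w x Y) {t : ℝ}
    (ht : t ∈ Icc r T) {u v : L2 r} (hu : u =ᵐ[delayMeasure r] fun ξ => (Y (t + ξ)).fst)
    (hv : v =ᵐ[delayMeasure r] fun ξ => z (t + ξ)) :
    Y t = opM a₁ b₁ (mkX (Y t).fst u) v := by
  have ht' : t ∈ Icc 0 T := ⟨hr.le.trans ht.1, ht.2⟩
  set h : ℝ → ℝ := (Icc 0 T).indicator fun s => (Y s).fst with hh
  set k : ℝ → ℝ := (Icc 0 T).indicator z with hk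
  have hneg : ∀ {a f : ℝ → ℝ} {c : ℝ}, ∫ s in Iic 0, a (c + s) * (Icc 0 T).indicator f s = 0 :=
    fun {a f c} => by
      rw [integral_Iic_eq_integral_Iio]
      refine setIntegral_eq_zero_of_forall_eq_zero fun s hs => ?_
      rw [indicator_of_notMem (fun h' => absurd h'.1 (not_le.2 hs)), mul_zero]
  have hmem : ∀ ξ ∈ Icc (-r) 0, t + ξ ∈ Icc 0 T := fun ξ hξ =>
    ⟨by linarith [ht.1, hξ.1], by linarith [ht.2, hξ.2]⟩
  refine eq_opM a₁ b₁ (h := h) (k := k) (t := t) ?_ ?_ ?_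
  · filter_upwards [hu, ae_restrict_mem measurableSet_Icc] with ξ h1 hξ
    rw [h1, hh, indicator_of_mem (hmem ξ hξ)]
  · filter_upwards [hv, ae_restrict_mem measurableSet_Icc] with ξ h1 hξ
    rw [h1, hk, indicator_of_mem (hmem ξ hξ)]
  · refine snd_ae_eq_pastConv hr hT (hz.integrable (by norm_num)) hY hsol
      (integrable_indicator_of_memLp (memLp_of_continuousOn (continuous_fst_X hY).continuousOn))
      (integrable_indicator_of_memLp hz) (fun s hs => indicator_of_mem hs _)
      (fun s hs => indicator_of_mem hs _) ht' fun c hc => ?_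
    -- After the delay time, the initial datum has left the interval `[-r, 0]`.
    rw [hneg, hneg, hinge_eq_zero (zeroExt_of_lt _) (by linarith [ht.1]), add_zero]

/-- For an initial datum which is the image under `M` of a history, the state of a weak solution is
at all times the image under `M` of the segments of the solution of the delay equation with this
history, and of the control. -/
theorem pathwise_eq_of_delay_equation {r T a₀ b₀ σ η₀ : ℝ} (hr : 0 < r) (hT : 0 < T)
    {a₁ b₁ : L2 r} {z w η δ y : ℝ → ℝ} (hz : MemLp z 2 (volume.restrict (Icc 0 T)))
    (hη : MemLp η 2 (delayMeasure r)) (hδ : MemLp δ 2 (delayMeasure r)) {Y : ℝ → X r}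
    (hY : Continuous Y) (hsol : IsPathwiseWeakSolution a₀ b₀ σ a₁ b₁ T z w
      (opM a₁ b₁ (mkX η₀ hη.toLp) hδ.toLp) Y)
    (hyc : ContinuousOn y (Icc 0 T)) (hyη : ∀ ξ ∈ Ico (-r) 0, y ξ = η ξ)
    (hy : ∀ t ∈ Icc 0 T, y t = η₀ + (∫ s in (0 : ℝ)..t,
      (a₀ * y s + delayInt (zeroExt r a₁) ((Icc (-r) T).indicator y) s + b₀ * z s +
        delayInt (zeroExt r b₁) ((Icc (-r) T).indicator (glue δ z)) s)) + σ * w t)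
    {t : ℝ} (ht : t ∈ Icc 0 T) {u v : L2 r} (hu : u =ᵐ[delayMeasure r] fun ξ => y (t + ξ))
    (hv : v =ᵐ[delayMeasure r] fun ξ => glue δ z (t + ξ)) :
    Y t = opM a₁ b₁ (mkX (y t) u) v ∧ y t = (Y t).fst := by
  have ia := integrable_zeroExt a₁
  have ib := integrable_zeroExt b₁
  have za := zeroExt_of_lt (r := r) a₁
  have zb := zeroExt_of_lt (r := r) b₁
  have hzi : IntegrableOn z (Icc 0 T) := hz.integrable (by norm_num)
  set h : ℝ → ℝ := (Icc (-r) T).indicator (glue η fun s => (Y s).fst) with hhdef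
  set k : ℝ → ℝ := (Icc (-r) T).indicator (glue δ z) with hkdef
  set hy' : ℝ → ℝ := (Icc (-r) T).indicator y with hy'def
  have hsub : Icc 0 T ⊆ Icc (-r) T := Icc_subset_Icc_left (by linarith)
  have hh : Integrable h := integrable_indicator_of_memLp
    (memLp_glue hη (memLp_of_continuousOn (continuous_fst_X hY).continuousOn))
  have hk : Integrable k := integrable_indicator_of_memLp (memLp_glue hδ hz)
  have hyg : EqOn (glue η y) y (Icc (-r) T) := fun s hs => by
    rw [glue]
    split_ifs with h1
    · exact (hyη s ⟨hs.1, h1⟩).symm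
    · rfl
  have hyi : Integrable hy' := by
    have := integrable_indicator_of_memLp (memLp_glue hη (memLp_of_continuousOn hyc))
    rwa [indicator_congr hyg] at this
  have hhY : ∀ s ∈ Icc 0 T, h s = (Y s).fst := fun s hs => by
    rw [hhdef, indicator_of_mem (hsub hs), glue, if_neg (not_lt.2 hs.1)]
  have hkz : ∀ s ∈ Icc 0 T, k s = z s := fun s hs => by
    rw [hkdef, indicator_of_mem (hsub hs), glue, if_neg (not_lt.2 hs.1)]
  have hpast : ∀ {p f : ℝ → ℝ} (hp : MemLp p 2 (delayMeasure r)), hp.toLp =ᵐ[delayMeasure r]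
      fun ξ => (Icc (-r) T).indicator (glue p f) (0 + ξ) := fun {p f} hp => by
    filter_upwards [hp.coeFn_toLp, ae_restrict_mem measurableSet_Icc,
      ae_restrict_of_ae (Measure.ae_ne volume (0 : ℝ))] with ξ h1 hξ hne
    rw [h1, zero_add, indicator_of_mem (show ξ ∈ Icc (-r) T from ⟨hξ.1, hξ.2.trans hT.le⟩), glue,
      if_pos (lt_of_le_of_ne hξ.2 hne)]
  set x : X r := opM a₁ b₁ (mkX η₀ hη.toLp) hδ.toLp with hxdef
  have hx : x.snd =ᵐ[delayMeasure r]
      fun ξ => pastConv (zeroExt r a₁) h 0 ξ + pastConv (zeroExt r b₁) k 0 ξ :=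
    opM_snd_ae_eq a₁ b₁ (x := mkX η₀ hη.toLp) (hpast hη) (hpast hδ)
  have hxh : ∀ c ≤ 0, hinge (zeroExt r x.snd) c =
      (∫ u in Iic 0, hinge (zeroExt r a₁) (c + u) * h u) +
      ∫ u in Iic 0, hinge (zeroExt r b₁) (c + u) * k u := fun c hc => by
    have e1 : hinge (zeroExt r x.snd) c =
        hinge (fun ξ => pastConv (zeroExt r a₁) h 0 ξ + pastConv (zeroExt r b₁) k 0 ξ) c := by
      refine integral_congr_ae ?_
      filter_upwards [(ae_restrict_iff' measurableSet_Icc).1 hx] with ξ h1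
      rcases lt_or_ge ξ (-r) with h2 | h2
      · rw [zeroExt_of_lt _ ξ h2, pastConv_eq_zero za 0 h2, pastConv_eq_zero zb 0 h2, add_zero]
      · rcases le_or_gt ξ 0 with h3 | h3
        · rw [zeroExt_of_mem _ ⟨h2, h3⟩, h1 ⟨h2, h3⟩]
        · rw [max_eq_right (by linarith), zero_mul, zero_mul]
    rw [e1, hinge_add (integrable_pastConv ia hh 0) (fun ξ hξ => pastConv_eq_zero za 0 hξ)
      (integrable_pastConv ib hk 0) (fun ξ hξ => pastConv_eq_zero zb 0 hξ),
      hinge_pastConv ia za hh, hinge_pastConv ib zb hk, sub_zero]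
  have hsnd : ∀ t ∈ Icc 0 T, (Y t).snd =ᵐ[delayMeasure r]
      fun ξ => pastConv (zeroExt r a₁) h t ξ + pastConv (zeroExt r b₁) k t ξ := fun t ht =>
    snd_ae_eq_pastConv hr hT hzi hY hsol hh hk hhY hkz ht
      fun c hc => hxh (c - t) (by linarith [ht.1])
  -- The difference of the two solutions of the delay equation vanishes.
  have hfst : ∀ t ∈ Icc 0 T, (Y t).fst - y t = 0 := by
    refine eq_zero_of_delay_equation (a₀ := a₀) (e := fun s => h s - hy' s) ia
      ((continuous_fst_X hY).continuousOn.sub hyc) (hh.sub hyi) ?_ ?_ ?_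
    · intro s hs
      rw [hhY s hs, hy'def, indicator_of_mem (hsub hs)]
    · intro s hs
      by_cases hs' : s ∈ Icc (-r) T
      · simp only [hhdef, hy'def]
        rw [indicator_of_mem hs', indicator_of_mem hs', glue, if_pos hs, hyη s ⟨hs'.1, hs⟩,
          sub_self]
      · simp [hhdef, hy'def, hs']
    · intro t ht
      have iy : IntervalIntegrable y volume 0 t := by
        refine ContinuousOn.intervalIntegrable ?_
        rw [uIcc_of_le ht.1]; exact hyc.mono (Icc_subset_Icc_right ht.2)
      have iz : IntervalIntegrable z volume 0 t := by
        rw [intervalIntegrable_iff_integrableOn_Ioc_of_le ht.1]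
        exact hzi.mono_set (Ioc_subset_Icc_self.trans (Icc_subset_Icc_right ht.2))
      have iY : IntervalIntegrable (fun s => (Y s).fst) volume 0 t :=
        (continuous_fst_X hY).intervalIntegrable _ _
      have iA : IntervalIntegrable (delayInt (zeroExt r a₁) hy') volume 0 t :=
        (integrable_delayInt ia hyi).intervalIntegrable
      have iB : IntervalIntegrable (delayInt (zeroExt r b₁) k) volume 0 t :=
        (integrable_delayInt ib hk).intervalIntegrable
      have h1 := hy t ht
      rw [intervalIntegral.integral_add (((iy.const_mul _).add iA).add (iz.const_mul _)) iB,
        intervalIntegral.integral_add ((iy.const_mul _).add iA) (iz.const_mul _),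
        intervalIntegral.integral_add (iy.const_mul _) iA, intervalIntegral.integral_const_mul,
        intervalIntegral.integral_const_mul] at h1
      have h2 := fst_eq_delay_equation hr hzi hY hsol hh hk hhY hkz ht hx (hsnd t ht)
      have hx0 : x.fst = η₀ := rfl
      have i1 : ∀ {g : ℝ → ℝ}, Integrable g →
          Integrable fun ζ => zeroExt r a₁ ζ * (cumul g (t + ζ) - cumul g ζ) := fun {g} hg => by
        have i2 := integrable_mul_cumul ia hg 0
        simp only [zero_add] at i2
        simp_rw [mul_sub]; exact (integrable_mul_cumul ia hg t).sub i2
      have hcs : ∀ c, cumul (fun s => h s - hy' s) c = cumul h c - cumul hy' c := fun c =>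
        integral_sub hh.integrableOn hyi.integrableOn
      have h3 : ∫ ζ, zeroExt r a₁ ζ * (cumul (fun s => h s - hy' s) (t + ζ) -
          cumul (fun s => h s - hy' s) ζ) =
          (∫ s in (0 : ℝ)..t, delayInt (zeroExt r a₁) h s) -
            ∫ s in (0 : ℝ)..t, delayInt (zeroExt r a₁) hy' s := by
        rw [integral_delayInt ia hh, integral_delayInt ia hyi, ← integral_sub (i1 hh) (i1 hyi)]
        refine integral_congr_ae (Filter.Eventually.of_forall fun ζ => ?_)
        simp only [hcs]
        ring
      rw [h3, intervalIntegral.integral_sub iY iy, h1, h2, hx0]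
      ring
  have hty : y t = (Y t).fst := (sub_eq_zero.1 (hfst t ht)).symm
  refine ⟨?_, hty⟩
  rw [hty]
  refine eq_opM a₁ b₁ (h := h) (k := k) (t := t) ?_ ?_ (hsnd t ht)
  · filter_upwards [hu, ae_restrict_mem measurableSet_Icc] with ξ h1 hξ
    have hm : t + ξ ∈ Icc (-r) T := ⟨by linarith [ht.1, hξ.1], by linarith [ht.2, hξ.2]⟩
    rw [h1, hhdef, indicator_of_mem hm, glue]
    split_ifs with h2
    · exact hyη _ ⟨hm.1, h2⟩
    · exact (sub_eq_zero.1 (hfst _ ⟨not_lt.1 h2, hm.2⟩)).symm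
  · filter_upwards [hv, ae_restrict_mem measurableSet_Icc] with ξ h1 hξ
    have hm : t + ξ ∈ Icc (-r) T := ⟨by linarith [ht.1, hξ.1], by linarith [ht.2, hξ.2]⟩
    rw [h1, hkdef, indicator_of_mem hm]

/-! ### From almost sure identities to identities of paths -/

variable {Ω : Type*} [MeasurableSpace Ω] {P : Measure Ω}

/-- Two processes with continuous paths over a separable index space which agree almost surely at
every index are indistinguishable. -/
lemma ae_forall_eq_of_continuous {S : Type*} [TopologicalSpace S] [TopologicalSpace.SeparableSpace S]
    {f g : S → Ω → ℝ} (hf : ∀ᵐ ω ∂P, Continuous fun s => f s ω)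
    (hg : ∀ᵐ ω ∂P, Continuous fun s => g s ω) (h : ∀ s, ∀ᵐ ω ∂P, f s ω = g s ω) :
    ∀ᵐ ω ∂P, ∀ s, f s ω = g s ω := by
  obtain ⟨D, hDc, hD⟩ := TopologicalSpace.exists_countable_dense S
  have h1 : ∀ᵐ ω ∂P, ∀ s ∈ D, f s ω = g s ω := (ae_ball_iff hDc).2 fun s _ => h s
  filter_upwards [hf, hg, h1] with ω h2 h3 h4 s
  exact congrFun (h2.ext_on hD h3 h4) s

lemma IsAdmissibleControl.ae_memLp [SFinite P] {𝓕 : Filtration ℝ≥0 ‹MeasurableSpace Ω›} {T : ℝ≥0}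
    {z : ℝ → Ω → ℝ} (hz : IsAdmissibleControl P 𝓕 T z) :
    ∀ᵐ ω ∂P, MemLp (fun s => z s ω) 2 (volume.restrict (Icc (0 : ℝ) T)) := by
  have h1 := hz.memLp.aestronglyMeasurable.prod_swap.prodMk_left
  have h2 := hz.memLp.integrable_sq.prod_left_ae
  filter_upwards [h1, h2] with ω h3 h4
  exact (memLp_two_iff_integrable_sq h3).2 h4

/-- Almost surely, the path of a weak solution with continuous paths satisfies the weak formulation
for all test elements and all times simultaneously. -/
theorem IsWeakSolution.ae_isPathwiseWeakSolution [SFinite P] {W : ℝ≥0 → Ω → ℝ}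
    (hW : ∀ᵐ ω ∂P, Continuous fun t => W t ω) {r : ℝ} {T : ℝ≥0} {a₀ b₀ σ : ℝ} {a₁ b₁ : L2 r}
    {𝓕 : Filtration ℝ≥0 ‹MeasurableSpace Ω›} {z : ℝ → Ω → ℝ} (hz : IsAdmissibleControl P 𝓕 T z)
    {x : X r} {Y : ℝ → Ω → X r}
    (hsol : IsWeakSolution P 𝓕 T W (opAStar a₀ a₁) (opB b₀ b₁) (opG r σ) z x Y)
    (hY : HasContinuousPaths P T Y) :
    ∀ᵐ ω ∂P, IsPathwiseWeakSolution a₀ b₀ σ a₁ b₁ T (fun s => z s ω)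
      (fun t => W t.toNNReal ω) x (fun s => Y (projIcc (0 : ℝ) T T.coe_nonneg s) ω) := by
  set Y' : ℝ → Ω → X r := fun s ω => Y (projIcc (0 : ℝ) T T.coe_nonneg s) ω with hY'
  have hYY : ∀ s ∈ Icc (0 : ℝ) T, ∀ ω, Y' s ω = Y s ω := fun s hs ω => by
    simp only [hY', projIcc_of_mem T.coe_nonneg hs]
  set z' : ℝ → Ω → ℝ := fun s ω => (Icc (0 : ℝ) T).indicator (fun s => z s ω) s with hz'
  have hYc : ∀ᵐ ω ∂P, Continuous fun s => Y' s ω := by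
    filter_upwards [hY] with ω h
    exact (continuousOn_iff_continuous_domRestrict.1 h).comp continuous_projIcc
  have hzi : ∀ᵐ ω ∂P, Integrable fun s => z' s ω := by
    filter_upwards [hz.ae_memLp] with ω h
    exact integrable_indicator_of_memLp h
  -- The right hand side, in a form which is jointly continuous in the time and the test element.
  set E : ℝ → X r × X r → Ω → ℝ := fun t p ω => ⟪x, p.1⟫_ℝ +
    (⟪∫ s in (0 : ℝ)..t, Y' s ω, p.2⟫_ℝ + (∫ s in (0 : ℝ)..t, z' s ω) * ⟪mkX b₀ b₁, p.1⟫_ℝ) +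
    ⟪opG r σ (W t.toNNReal ω), p.1⟫_ℝ with hE
  have hEc : ∀ᵐ ω ∂P, Continuous fun q : ℝ × (X r × X r) => E q.1 q.2 ω := by
    filter_upwards [hYc, hzi, hW] with ω h1 h2 h3
    have c1 : Continuous fun t : ℝ => ∫ s in (0 : ℝ)..t, Y' s ω :=
      intervalIntegral.continuous_primitive (fun _ _ => h1.intervalIntegrable _ _) 0
    have c2 : Continuous fun t : ℝ => ∫ s in (0 : ℝ)..t, z' s ω :=
      intervalIntegral.continuous_primitive (fun _ _ => h2.intervalIntegrable) 0
    have c3 : Continuous fun t : ℝ => opG r σ (W t.toNNReal ω) :=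
      (opG r σ).continuous.comp (h3.comp continuous_real_toNNReal)
    exact ((continuous_const.inner continuous_snd.fst).add
      (((c1.comp continuous_fst).inner continuous_snd.snd).add
        ((c2.comp continuous_fst).mul (continuous_const.inner continuous_snd.fst)))).add
      ((c3.comp continuous_fst).inner continuous_snd.fst)
  have hEq : ∀ᵐ ω ∂P, ∀ t ∈ Icc (0 : ℝ) T, ∀ p : X r × X r, E t p ω = ⟪x, p.1⟫_ℝ +
      (∫ s in (0 : ℝ)..t, (⟪Y' s ω, p.2⟫_ℝ + ⟪opB b₀ b₁ (z s ω), p.1⟫_ℝ)) +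
      ⟪opG r σ (W t.toNNReal ω), p.1⟫_ℝ := by
    filter_upwards [hYc, hzi] with ω h1 h2 t ht p
    have e : ∫ s in (0 : ℝ)..t, (⟪Y' s ω, p.2⟫_ℝ + ⟪opB b₀ b₁ (z s ω), p.1⟫_ℝ) =
        ∫ s in (0 : ℝ)..t, (⟪Y' s ω, p.2⟫_ℝ + z' s ω * ⟪mkX b₀ b₁, p.1⟫_ℝ) := by
      refine intervalIntegral.integral_congr fun s hs => ?_
      rw [uIcc_of_le ht.1] at hs
      simp only [hz']
      rw [inner_opB, indicator_of_mem (show s ∈ Icc (0 : ℝ) T from ⟨hs.1, hs.2.trans ht.2⟩)]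
    have e2 : ∫ s in (0 : ℝ)..t, ⟪Y' s ω, p.2⟫_ℝ = ⟪∫ s in (0 : ℝ)..t, Y' s ω, p.2⟫_ℝ := by
      rw [real_inner_comm]
      simp_rw [fun s => real_inner_comm p.2 (Y' s ω)]
      exact (innerSL ℝ p.2).intervalIntegral_comp_comm (h1.intervalIntegrable _ _)
    rw [e, intervalIntegral.integral_add, e2, intervalIntegral.integral_mul_const]
    · exact (h1.inner continuous_const).intervalIntegrable _ _
    · exact h2.intervalIntegrable.mul_const _
  have : Fact ((2 : ℝ≥0∞) ≠ ∞) := ⟨by simp⟩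
  have : SecondCountableTopology (X r) := inferInstance
  have : TopologicalSpace.SeparableSpace (opAStar a₀ a₁).graph :=
    TopologicalSpace.SecondCountableTopology.to_separableSpace
  have main := ae_forall_eq_of_continuous (P := P)
    (S := Icc (0 : ℝ) T × (opAStar a₀ a₁).graph)
    (f := fun q ω => ⟪Y' q.1 ω, (q.2 : X r × X r).1⟫_ℝ) (g := fun q ω => E q.1 q.2 ω) ?_ ?_ ?_
  · filter_upwards [main, hEq] with ω h1 h2 p hp t ht
    rw [← h2 t ht p]
    exact h1 (⟨t, ht⟩, ⟨p, hp⟩)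
  · filter_upwards [hYc] with ω h
    exact (h.comp (continuous_subtype_val.comp continuous_fst)).inner
      (continuous_subtype_val.comp continuous_snd).fst
  · filter_upwards [hEc] with ω h
    exact h.comp ((continuous_subtype_val.comp continuous_fst).prodMk
      (continuous_subtype_val.comp continuous_snd))
  · rintro ⟨⟨t, ht⟩, ⟨p, hp⟩⟩
    obtain ⟨ζ, h1, h2⟩ := (opAStar a₀ a₁).mem_graph_iff.1 hp
    filter_upwards [hsol.eqn ζ ⟨t, ht.1⟩ ht.2, hEq] with ω h3 h4
    rw [h4 t ht p, hYY t ht, ← h1, ← h2, Real.toNNReal_of_nonneg ht.1]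
    refine h3.trans ?_
    congr 2
    refine intervalIntegral.integral_congr fun s hs => ?_
    change s ∈ uIcc 0 t at hs
    rw [uIcc_of_le ht.1] at hs
    rw [hYY s ⟨hs.1, hs.2.trans ht.2⟩]

/-- Almost surely, a solution of the delay equation satisfies it at all times simultaneously. -/
lemma IsSDDESolution.ae_forall_eqn [SFinite P] {W : ℝ≥0 → Ω → ℝ}
    (hW : ∀ᵐ ω ∂P, Continuous fun t => W t ω) {r : ℝ} (hr : 0 < r) {T : ℝ≥0}
    {a₀ b₀ σ η₀ : ℝ} {a₁ b₁ : L2 r} {𝓕 : Filtration ℝ≥0 ‹MeasurableSpace Ω›} {z : ℝ → Ω → ℝ}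
    (hz : IsAdmissibleControl P 𝓕 T z) {η δ : ℝ → ℝ} (hη : MemLp η 2 (delayMeasure r))
    (hδ : MemLp δ 2 (delayMeasure r)) {y : ℝ → Ω → ℝ}
    (hy : IsSDDESolution P 𝓕 T W a₀ b₀ σ a₁ b₁ η₀ η (withHistory δ z) y) :
    ∀ᵐ ω ∂P, ∀ t ∈ Icc (0 : ℝ) T, y t ω = η₀ + (∫ s in (0 : ℝ)..t,
      (a₀ * y s ω + delayInt (zeroExt r a₁) ((Icc (-r) T).indicator fun s => y s ω) s +
        b₀ * z s ω + delayInt (zeroExt r b₁)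
          ((Icc (-r) T).indicator (glue δ fun s => z s ω)) s)) + σ * W t.toNNReal ω := by
  set D : ℝ → Ω → ℝ := fun s ω =>
    a₀ * y s ω + delayInt (zeroExt r a₁) ((Icc (-r) T).indicator fun s => y s ω) s +
      b₀ * z s ω + delayInt (zeroExt r b₁) ((Icc (-r) T).indicator (glue δ fun s => z s ω)) s
    with hD
  have hDi : ∀ᵐ ω ∂P, IntegrableOn (fun s => D s ω) (Icc (0 : ℝ) T) := by
    filter_upwards [hz.ae_memLp, hy.continuous, hy.history] with ω h1 h2 h3
    have hyi : Integrable ((Icc (-r) (T : ℝ)).indicator fun s => y s ω) := by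
      have := integrable_indicator_of_memLp (memLp_glue hη (memLp_of_continuousOn h2))
      rwa [indicator_congr (g := fun s => y s ω)] at this
      intro s hs
      rw [glue]
      split_ifs with h
      · exact (h3 s ⟨hs.1, h⟩).symm
      · rfl
    have hki := integrable_indicator_of_memLp (memLp_glue hδ h1)
    exact (((h2.integrableOn_compact isCompact_Icc).const_mul _).add
      (integrable_delayInt (integrable_zeroExt a₁) hyi).integrableOn |>.add
        (Integrable.const_mul (h1.integrable (by norm_num)) _)).add
      (integrable_delayInt (integrable_zeroExt b₁) hki).integrableOn
  have main := ae_forall_eq_of_continuous (P := P) (S := Icc (0 : ℝ) T) (f := fun t ω => y t ω)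
    (g := fun t ω => η₀ + (∫ s in (0 : ℝ)..t, D s ω) + σ * W (t : ℝ).toNNReal ω) ?_ ?_ ?_
  · filter_upwards [main] with ω h t ht
    exact h ⟨t, ht⟩
  · filter_upwards [hy.continuous] with ω h
    exact continuousOn_iff_continuous_domRestrict.1 h
  · filter_upwards [hDi, hW] with ω h1 h2
    have c1 : ContinuousOn (fun t : ℝ => ∫ s in (0 : ℝ)..t, D s ω) (Icc 0 T) := by
      have := intervalIntegral.continuousOn_primitive_interval (f := fun s => D s ω) (a := 0)
        (b := T) (μ := volume) (by rwa [uIcc_of_le T.coe_nonneg])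
      rwa [uIcc_of_le T.coe_nonneg] at this
    exact (continuous_const.add (continuousOn_iff_continuous_domRestrict.1 c1)).add
      (continuous_const.mul (h2.comp (continuous_real_toNNReal.comp continuous_subtype_val)))
  · rintro ⟨t, ht⟩
    filter_upwards [hy.eqn ⟨t, ht.1⟩ ht.2] with ω h
    rw [Real.toNNReal_of_nonneg ht.1]
    refine h.trans ?_
    congr 2
    refine intervalIntegral.integral_congr fun s hs => ?_
    change s ∈ uIcc 0 t at hs
    rw [uIcc_of_le ht.1] at hs
    have hs' : s ∈ Icc (0 : ℝ) T := ⟨hs.1, hs.2.trans ht.2⟩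
    have hzs : withHistory δ z s ω = z s ω := if_neg (not_lt.2 hs.1)
    simp only [hD]
    rw [hzs, integral_mul_segment_eq_delayInt hr a₁ (fun s => y s ω) hs',
      integral_mul_segment_eq_delayInt hr b₁ (fun s => withHistory δ z s ω) hs']
    rfl

end DelaySDE

end

open DelaySDE in
theorem mainTheorem2 {Ω : Type*} [MeasurableSpace Ω] (P : Measure Ω) [IsProbabilityMeasure P]
    (W : ℝ≥0 → Ω → ℝ) (hWm : ∀ t, Measurable (W t)) (hW : IsBrownianReal W P)
    (r : ℝ) (hr : 0 < r) (T : ℝ≥0) (hT : 0 < T)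
    (a₀ b₀ σ : ℝ) (a₁ b₁ : L2 r) (z : ℝ → Ω → ℝ)
    (hz : IsAdmissibleControl P (completedFiltration P W hWm) T z) :
    (∀ (x : X r) (Y : ℝ → Ω → X r),
      IsWeakSolution P (completedFiltration P W hWm) T W (opAStar a₀ a₁) (opB b₀ b₁) (opG r σ)
        z x Y →
      HasContinuousPaths P T Y →
      ∀ᵐ ω ∂P, ∀ t ∈ Icc r (T : ℝ),
        ∃ (hY₀ : MemLp (fun ξ => (Y (t + ξ) ω).fst) 2 (delayMeasure r))
          (hzt : MemLp (fun ξ => z (t + ξ) ω) 2 (delayMeasure r)),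
          Y t ω = opM a₁ b₁ (mkX (Y t ω).fst hY₀.toLp) hzt.toLp) ∧
    (∀ (η₀ : ℝ) (η δ : ℝ → ℝ) (hη : MemLp η 2 (delayMeasure r))
      (hδ : MemLp δ 2 (delayMeasure r)) (y : ℝ → Ω → ℝ) (Y : ℝ → Ω → X r),
      IsSDDESolution P (completedFiltration P W hWm) T W a₀ b₀ σ a₁ b₁ η₀ η
        (withHistory δ z) y →
      IsWeakSolution P (completedFiltration P W hWm) T W (opAStar a₀ a₁) (opB b₀ b₁) (opG r σ)
        z (opM a₁ b₁ (mkX η₀ hη.toLp) hδ.toLp) Y →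
      HasContinuousPaths P T Y →
      ∀ᵐ ω ∂P, ∀ t ∈ Icc 0 (T : ℝ),
        (∃ (hyt : MemLp (fun ξ => y (t + ξ) ω) 2 (delayMeasure r))
          (hzt : MemLp (fun ξ => withHistory δ z (t + ξ) ω) 2 (delayMeasure r)),
          Y t ω = opM a₁ b₁ (mkX (y t ω) hyt.toLp) hzt.toLp) ∧
        y t ω = (Y t ω).fst) := by

  have hT' : (0 : ℝ) < T := hT
  constructor
  · intro x Y hsol hY
    filter_upwards [hsol.ae_isPathwiseWeakSolution hW.cont hz hY, hY, hz.ae_memLp]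
      with ω hω hYω hzω t ht
    have hYc : Continuous fun s => Y (projIcc (0 : ℝ) T T.coe_nonneg s) ω :=
      (continuousOn_iff_continuous_domRestrict.1 hYω).comp continuous_projIcc
    have hproj : ∀ s ∈ Icc (0 : ℝ) T, Y (projIcc (0 : ℝ) T T.coe_nonneg s) ω = Y s ω := fun s hs => by
      rw [projIcc_of_mem T.coe_nonneg hs]
    have hcf : ContinuousOn (fun s => (Y s ω).fst) (Icc (0 : ℝ) T) :=
      (continuous_fst_X hYc).continuousOn.congr fun s hs => by simp only [hproj s hs]
    have hY₀ := memLp_segment (memLp_of_continuousOn hcf) (r := r) (by linarith [ht.1]) ht.2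
    have hzt := memLp_segment hzω (r := r) (by linarith [ht.1]) ht.2
    refine ⟨hY₀, hzt, ?_⟩
    have key := pathwise_eq_opM_of_le hr hT' hzω hYc hω ht (u := hY₀.toLp) (v := hzt.toLp) ?_
      hzt.coeFn_toLp
    · rwa [hproj t ⟨hr.le.trans ht.1, ht.2⟩] at key
    · filter_upwards [hY₀.coeFn_toLp, ae_restrict_mem measurableSet_Icc] with ξ h1 hξ
      rw [h1, hproj _ ⟨by linarith [ht.1, hξ.1], by linarith [ht.2, hξ.2]⟩]
  · intro η₀ η δ hη hδ y Y hy hsol hY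
    filter_upwards [hsol.ae_isPathwiseWeakSolution hW.cont hz hY, hY, hz.ae_memLp,
      hy.ae_forall_eqn hW.cont hr hz hη hδ, hy.continuous, hy.history]
      with ω hω hYω hzω hyω hyc hyη t ht
    have hYc : Continuous fun s => Y (projIcc (0 : ℝ) T T.coe_nonneg s) ω :=
      (continuousOn_iff_continuous_domRestrict.1 hYω).comp continuous_projIcc
    have hproj : Y (projIcc (0 : ℝ) T T.coe_nonneg t) ω = Y t ω := by rw [projIcc_of_mem T.coe_nonneg ht]
    have hyt : MemLp (fun ξ => y (t + ξ) ω) 2 (delayMeasure r) := by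
      refine (memLp_segment (memLp_glue hη (memLp_of_continuousOn hyc)) (r := r)
        (by linarith [ht.1]) ht.2).ae_eq ?_
      filter_upwards [ae_restrict_mem measurableSet_Icc] with ξ hξ
      rw [glue]
      split_ifs with h
      · exact (hyη _ ⟨by linarith [ht.1, hξ.1], h⟩).symm
      · rfl
    have hzt : MemLp (fun ξ => withHistory δ z (t + ξ) ω) 2 (delayMeasure r) :=
      memLp_segment (memLp_glue hδ hzω) (r := r) (by linarith [ht.1]) ht.2
    have key := pathwise_eq_of_delay_equation hr hT' hzω hη hδ hYc hω hyc hyη hyω ht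
      hyt.coeFn_toLp hzt.coeFn_toLp
    rw [hproj] at key
    exact ⟨⟨hyt, hzt, key.1⟩, key.2⟩
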